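/- **Setting.** Let $J=[-\tfrac12,\tfrac12]$. A dynamic function on an open interval $S\subseteq\mathbb R$ assigns to each $t\in S$ a function $f(t)(\cdot)$ on $J$ (its dynamic value at $t$); the value is ordinary if it is constant, and $D(f)$ is the set of $t$ with a non-ordinary value. One-sided limits $f(t\pm)$ are taken uniformly in $s\in J$. The space $\mathcal T(S)$ of test functions consists of the dynamic functions with compact support in $S$ that have one-sided limits at all points and whose dynamic values are bounded with one-sided limits on $J$; $\hat\varphi$ denotes the ordinary part of $\varphi$ (its value at $t\notin D(\varphi)$). Distributions in $\mathcal T'(S)$ are functionals on $\mathcal T(S)$: a locally integrable $h$ acts by $\int h\hat\varphi\,dt$, the delta-function with shape $\alpha$, $\int_J\alpha=1$, acts by $(\delta_\tau^\alpha,\varphi)=\int_J\alpha(s)\varphi(\tau)(s)\,ds$, products are $(\gamma F,\varphi)=(F,\gamma\varphi)$, and $F\le 0$ in $\mathcal T'(S)$ means $(F,\varphi)\le 0$ for all $\varphi\ge 0$ in $\mathcal T(S)$. The class $s\mathbb G$ consists of the dynamic functions with $f(t)(\cdot)$ absolutely continuous on $J$, $f(t)(-\frac12)=f(t-)$, $f(t)(\frac12)=f(t+)$;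 the class $s\mathbb{BV}^{loc}$ of those $f\in s\mathbb G$ whose ordinary part has locally bounded variation and for which $\sum_{t\in D(f)\cap K}\mathrm{var}_J f(t)(\cdot)<\infty$ for compact $K$. For such $f$, with continuous part $f_c$, $(\dot f,\varphi)=\int\hat\varphi\,df_c+\sum_{\tau\in D(f)}\int_J\varphi(\tau)(s)\,\partial_s f(\tau)(s)\,ds$. For vectors everything is componentwise. **Data.** Let $I\subseteq\mathbb R$ be an open interval, $t_0\in I$, $\Omega=(t_0,T)\subseteq I$ with $t_0<T\le\infty$. Let $\eta_1,\dots,\eta_m:\mathbb R^n\to\mathbb R$ be $C^1$, $M=\{x:\eta_i(x)\le 0,\ 1\le i\le m\}$, $L_x=\{i:\eta_i(x)=0\}$, and let $N\supseteq M$ be open. Let $f:I\times N\to\mathbb R^n$ be Carathéodory, Lipschitz in $x$ uniformly in $t$, and continuous in $t\in\Omega$; let $g:I\times N\to\mathbb R^{n\times n}$ belong to $s\mathbb G$ in $t$ (locally in $I$) and be Lipschitz in $x$ uniformly in $t$ (for all its dynamic values). Let $$v=w+\sum_{k=1}^\infty\langle c_k,\delta_{\tau_k}^{\alpha_k}\rangle$$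 with $w:I\to\mathbb R^n$ continuous, distinct points $\tau_k\in I$, $c_k\in\mathbb R^n$, continuous $\alpha_k:J\to\mathbb R^n$ each of whose components has integral $1$ ($\langle\cdot,\cdot\rangle$ is the componentwise product), such that the series converges and $v=\dot u$ in $\mathcal T_n'(I)$ for some $u\in s\mathbb{BV}^{loc}_n(I)$. A solution of $\dot x=f(t,x)+g(t,x)v$, $x(t_0-)=x_0$, on an open interval $W\subseteq I$ containing $t_0$ is an $x\in s\mathbb{BV}_n^{loc}(W)$ with values $x(t)(s)\in N$ that satisfies the equation in $\mathcal T_n'(W)$ and has $x(t_0-)=x_0$. **Theorem.** Suppose that the gradients $\dot\eta_i(x)$, $i\in L_x$, are linearly independent for every $x\in\partial M$. Suppose that for all $x\in\partial M$ and $i\in L_x$ $$\bigl(\dot\eta_i(x),\,f(t,x)+g(t,x)v\bigr)\le 0\quad\text{in }\mathcal T'(\Omega),$$ and, if $t_0=\tau_k$ for some $k$, that also $\bigl(\dot\eta_i(x),\,g(t,x)\langle c_k,\delta_{\tau_k}^{\alpha_k}\rangle\bigr)\le 0$ in $\mathcal T'(I)$. Then $M$ has the property of viability on $\Omega$: for every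 solution $x$ with $x(t_0-)\in M$ on any such interval $W$, $x(t)(s)\in M$ for all $s\in J$ and all $t\in\Omega\cup\{t_0\}$ at which $x$ is defined (so for all $t\in\Omega\cup\{t_0\}$ if $\Omega\subseteq W$). -/

import Mathlib

open Set Filter Topology MeasureTheory

namespace DynDist

noncomputable section

/-- The interval `J = [-1/2, 1/2]` on which dynamic values live. -/
def J : Set ℝ := Icc (-1 / 2) (1 / 2)

/-- A dynamic function: `f t` is the dynamic value of `f` at `t`, a function on `J`
(only the values `f t s` with `s ∈ J` matter). -/
abbrev DynFun := ℝ → ℝ → ℝ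

/-- `f(τ-) = c`: the left-sided limit of the dynamic function `f` at `τ`, uniform in `s ∈ J`. -/
def HasLeftLim (f : DynFun) (τ c : ℝ) : Prop :=
  Tendsto (fun p : ℝ × ℝ => f p.1 p.2) (𝓝[<] τ ×ˢ 𝓟 J) (𝓝 c)

/-- `f(τ+) = c`: the right-sided limit of the dynamic function `f` at `τ`, uniform in `s ∈ J`. -/
def HasRightLim (f : DynFun) (τ c : ℝ) : Prop :=
  Tendsto (fun p : ℝ × ℝ => f p.1 p.2) (𝓝[>] τ ×ˢ 𝓟 J) (𝓝 c)

/-- `D(f)`: the points at which the value of `f` is not ordinary, i.e. not constant on `J`. -/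
def dynPts (f : DynFun) : Set ℝ := {t | ∃ s ∈ J, f t s ≠ f t 0}

/-- The ordinary part of `f`: at `t ∉ D(f)` this is the (constant) value of `f` at `t`.
For regulated dynamic functions `D(f)` is at most countable, and the value chosen on `D(f)`
never matters, since ordinary parts are only integrated against measures without atoms. -/
def ord (f : DynFun) : ℝ → ℝ := fun t => f t 0

/-- Regulated functions on `J`: bounded, with one-sided limits at all points. -/
structure IsRegulatedJ (h : ℝ → ℝ) : Prop where
  bounded : ∃ C, ∀ s ∈ J, |h s| ≤ C
  right : ∀ s ∈ Ico (-1 / 2 : ℝ) (1 / 2), ∃ c, Tendsto h (𝓝[>] s) (𝓝 c)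
  left : ∀ s ∈ Ioc (-1 / 2 : ℝ) (1 / 2), ∃ c, Tendsto h (𝓝[<] s) (𝓝 c)

/-- A regulated dynamic function which vanishes off `[p, q]`. -/
structure IsTestOn (p q : ℝ) (φ : DynFun) : Prop where
  values : ∀ t, IsRegulatedJ (φ t)
  left : ∀ t, ∃ c, HasLeftLim φ t c
  right : ∀ t, ∃ c, HasRightLim φ t c
  support : ∀ t, t ∉ Icc p q → ∀ s ∈ J, φ t s = 0

/-- The space `𝒯(S)` of dynamic test functions: regulated dynamic functions with compact
support in the interval `S` (extended by zero). -/
def IsTest (S : Set ℝ) (φ : DynFun) : Prop :=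
  ∃ p q, p ≤ q ∧ Icc p q ⊆ S ∧ IsTestOn p q φ

/-- Functionals on dynamic test functions; all those used below are explicit. Two of them are
equal as distributions in `𝒯'(S)` when they agree on `𝒯(S)`. -/
abbrev DynFunctional := DynFun → ℝ

/-- The regular distribution `φ ↦ ∫ h φ̂ dt`. -/
def regular (h : ℝ → ℝ) : DynFunctional := fun φ => ∫ t, h t * ord φ t

/-- The delta-function concentrated at `τ` with shape `α`. -/
def delta (τ : ℝ) (α : ℝ → ℝ) : DynFunctional :=
  fun φ => ∫ s in (-1 / 2 : ℝ)..(1 / 2), α s * φ τ s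

/-- The product `γF` of a dynamic function and a distribution: `(γF, φ) = (F, γφ)`. -/
def mulDist (γ : DynFun) (F : DynFunctional) : DynFunctional :=
  fun φ => F (fun t s => γ t s * φ t s)

/-- `F ≤ 0` in `𝒯'(S)`. -/
def NonposOn (S : Set ℝ) (F : DynFunctional) : Prop :=
  ∀ φ, IsTest S φ → (∀ t, ∀ s ∈ J, 0 ≤ φ t s) → F φ ≤ 0

/-- The class `s𝔾` on `S`: regulated dynamic functions whose dynamic values are absolutely
continuous on `J` and join the left-sided limit to the right-sided one. (Behaviour of `f` at the
ends of the interval `S` is not restricted.) -/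
structure IsSG (S : Set ℝ) (f : DynFun) : Prop where
  absCont : ∀ t ∈ S, AbsolutelyContinuousOnInterval (f t) (-1 / 2) (1 / 2)
  left : ∀ t ∈ S, HasLeftLim f t (f t (-1 / 2))
  right : ∀ t ∈ S, HasRightLim f t (f t (1 / 2))

/-- The class `s𝔹𝕍^loc` on `S`: dynamic functions of locally bounded variation. The variation of
the ordinary part, which is only determined up to its values at the jumps, is that of its
left-continuous representative `t ↦ f(t-) = f t (-1/2)`. -/
structure IsSBVLoc (S : Set ℝ) (f : DynFun) : Prop where
  isSG : IsSG S f
  ordBV : LocallyBoundedVariationOn (fun t => f t (-1 / 2)) S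
  dynBV : ∀ p q, Icc p q ⊆ S →
    ∑' τ : (dynPts f ∩ Icc p q : Set ℝ), eVariationOn (f τ) J ≠ ⊤

/-- The continuous part on `[p, q]` of the ordinary part of `f` (up to an additive constant):
`f(t-)` minus the sum of the jumps `f(τ+) - f(τ-)` over `p ≤ τ < t`. -/
def contPart (f : DynFun) (p : ℝ) : ℝ → ℝ := fun t =>
  f t (-1 / 2) - ∑' τ : (dynPts f ∩ Ico p t : Set ℝ), (f τ (1 / 2) - f τ (-1 / 2))

open scoped Classical in
/-- The Lebesgue–Stieltjes integral `∫_{[p,q]} h dF` of a continuous function `F` of bounded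
variation on `[p, q]` (`F` is extended by constants, so that `dF` is a finite signed measure on
the line; it is integrated through its Jordan decomposition). -/
def stieltjesIntegral (p q : ℝ) (h F : ℝ → ℝ) : ℝ :=
  if hF : BoundedVariationOn (fun t => F (max p (min t q))) univ then
    let μ : SignedMeasure ℝ := hF.vectorMeasure
    (∫ t, h t ∂μ.toJordanDecomposition.posPart) - ∫ t, h t ∂μ.toJordanDecomposition.negPart
  else 0

/-- The value on `φ` of the derivative of `f ∈ s𝔹𝕍^loc`, for a test function `φ` which
vanishes off `[p, q]`: `∫ φ̂ df_c + ∑_τ ∫_J φ(τ)(s) (f(τ)(s))˙_s ds`. -/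
def derivOn (p q : ℝ) (f : DynFun) : DynFunctional := fun φ =>
  stieltjesIntegral p q (ord φ) (contPart f p) +
    ∑' τ : (dynPts f ∩ Icc p q : Set ℝ), ∫ s in (-1 / 2 : ℝ)..(1 / 2), φ τ s * deriv (f τ) s

/-- `ḟ = F` in `𝒯'(S)`. -/
def DerivEq (S : Set ℝ) (f : DynFun) (F : DynFunctional) : Prop :=
  ∀ p q, p ≤ q → Icc p q ⊆ S → ∀ φ, IsTestOn p q φ → derivOn p q f φ = F φ

variable {n : ℕ}

/-- The `l`-th component of `∑_k ⟨c_k, δ_{τ_k}^{α_k}⟩` (componentwise products), term by term. -/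
def impulse (c : ℕ → Fin n → ℝ) (τ : ℕ → ℝ) (α : ℕ → ℝ → Fin n → ℝ) (k : ℕ) (l : Fin n) :
    DynFunctional :=
  fun φ => c k l * delta (τ k) (fun s => α k s l) φ

/-- The vector distribution `v = w + ∑_k ⟨c_k, δ_{τ_k}^{α_k}⟩`. -/
def control (w : ℝ → Fin n → ℝ) (c : ℕ → Fin n → ℝ) (τ : ℕ → ℝ) (α : ℕ → ℝ → Fin n → ℝ)
    (l : Fin n) : DynFunctional :=
  fun φ => regular (fun t => w t l) φ + ∑' k, impulse c τ α k l φ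

/-- The `i`-th component of the distribution `f(t, y) + g(t, y) v`, where `y` is a vector-valued
dynamic function and `g t s x` is the dynamic value at `s` of `g(·, x)` at `t`. -/
def rhs (f : ℝ → (Fin n → ℝ) → Fin n → ℝ) (g : ℝ → ℝ → (Fin n → ℝ) → Matrix (Fin n) (Fin n) ℝ)
    (v : Fin n → DynFunctional) (y : ℝ → ℝ → Fin n → ℝ) (i : Fin n) : DynFunctional :=
  fun φ => regular (ord (fun t s => f t (y t s) i)) φ +
    ∑ l, mulDist (fun t s => g t s (y t s) i l) (v l) φ

/-- The gradient of `η` at `x`. -/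
def grad (η : (Fin n → ℝ) → ℝ) (x : Fin n → ℝ) : Fin n → ℝ :=
  fun i => fderiv ℝ η x (Pi.single i 1)

/-- The Carathéodory conditions on `I × N`: measurable in `t`, continuous in `x`, and dominated
on compact sets by an integrable function of `t`. -/
structure IsCaratheodory (I : Set ℝ) (N : Set (Fin n → ℝ))
    (f : ℝ → (Fin n → ℝ) → Fin n → ℝ) : Prop where
  measurable : ∀ x ∈ N, AEStronglyMeasurable (fun t => f t x) (volume.restrict I)
  continuousOn : ∀ t ∈ I, ContinuousOn (f t) N
  dominated : ∀ p q, Icc p q ⊆ I → ∀ K ⊆ N, IsCompact K →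
    ∃ m : ℝ → ℝ, IntegrableOn m (Icc p q) ∧ ∀ t ∈ Icc p q, ∀ x ∈ K, ‖f t x‖ ≤ m t

/-- `x` is a solution on the open interval `W ∋ t₀` of the initial value problem
`ẋ = f(t,x) + g(t,x)v`, `x(t₀-) = x₀`, with values in `N`. -/
structure IsSolution (N : Set (Fin n → ℝ)) (f : ℝ → (Fin n → ℝ) → Fin n → ℝ)
    (g : ℝ → ℝ → (Fin n → ℝ) → Matrix (Fin n) (Fin n) ℝ) (v : Fin n → DynFunctional)
    (t₀ : ℝ) (x₀ : Fin n → ℝ) (W : Set ℝ) (x : ℝ → ℝ → Fin n → ℝ) : Prop where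
  isSBVLoc : ∀ i, IsSBVLoc W (fun t s => x t s i)
  mem : ∀ t ∈ W, ∀ s ∈ J, x t s ∈ N
  initial : ∀ i, HasLeftLim (fun t s => x t s i) t₀ (x₀ i)
  equation : ∀ i, DerivEq W (fun t s => x t s i) (rhs f g v x i)

/-- `M` has the property of viability on `Ω = (t₀, T)`: every solution with `x(t₀-) ∈ M`, on any
open interval `W ⊆ I` containing `t₀`, satisfies `x(t)(s) ∈ M` for all `s ∈ J` and all
`t ∈ Ω ∪ {t₀}` at which it is defined (so for all `t ∈ Ω ∪ {t₀}` when `Ω ⊆ W`). -/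
def HasViability (I : Set ℝ) (N : Set (Fin n → ℝ)) (f : ℝ → (Fin n → ℝ) → Fin n → ℝ)
    (g : ℝ → ℝ → (Fin n → ℝ) → Matrix (Fin n) (Fin n) ℝ) (v : Fin n → DynFunctional)
    (M : Set (Fin n → ℝ)) (t₀ : ℝ) (Ω : Set ℝ) : Prop :=
  ∀ W : Set ℝ, IsOpen W → W.OrdConnected → W ⊆ I → t₀ ∈ W →
    ∀ x₀ ∈ M, ∀ x, IsSolution N f g v t₀ x₀ W x →
      ∀ t ∈ W ∩ (Ω ∪ {t₀}), ∀ s ∈ J, x t s ∈ M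

end

end DynDist

/-! The proof is a Gronwall estimate for `E = sqDist M x`, the squared Euclidean distance of the
trajectory to `M`. It is run both through time and through the inner time `s` of each jump.

Geometry. Let `y` be a nearest point of `M` to `X ∉ M`. Linear independence of the active gradients
at `y` is a constraint qualification: `X - y` makes an obtuse angle with every `B` such that `grad
(η i) y ⬝ᵥ B ≤ 0` for all active `i`. An increment of `X` lying within `κ R ρ` of such a `B`, with
`R` comparable to the distance and `ρ` small, therefore multiplies `E` by at most `exp (n (4κ + 1)
ρ)` (`exists_sqDist_add_le`).

Increments as test values. The increments of a solution are values of the right-hand side on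
indicator test functions: `spike` for a piece of a jump (`derivOn_spike`), `bump` for an open time
interval (`derivOn_bump`). Freezing the state at the projection `y` turns the right-hand side into
the distribution of the hypothesis. Its values on these nonnegative test functions give a feasible
`B`, and the Lipschitz conditions bound the error by a multiple of `R` times `cutoffMass`, which
adds Lebesgue measure and the total variation of the impulses. This mass is locally finite because
the control has a primitive of locally bounded variation (`summable_impulseMass`).

Globalization. The local estimates are chained by continuous induction
(`le_of_forall_eventually_le`) against the barrier `ε exp (C · mass)`. Choosing `ε > 0` disposes of
the points where `E = 0`, at which the projection argument says nothing. Letting `ε → 0` gives `E =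
0`. -/

namespace DynDist

/-! ### Distance to a closed set -/

section Geometry

variable {n m : ℕ}

/-- The square of the Euclidean distance from `X` to `M`. -/
noncomputable def sqDist (M : Set (Fin n → ℝ)) (X : Fin n → ℝ) : ℝ :=
  Metric.infDist (WithLp.toLp 2 X : EuclideanSpace ℝ (Fin n)) (WithLp.ofLp ⁻¹' M) ^ 2

theorem sqDist_nonneg (M : Set (Fin n → ℝ)) (X : Fin n → ℝ) : 0 ≤ sqDist M X := sq_nonneg _

theorem continuous_sqDist (M : Set (Fin n → ℝ)) : Continuous (sqDist M) := by
  unfold sqDist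
  exact ((Metric.continuous_infDist_pt _).comp (PiLp.continuous_toLp 2 _)).pow 2

theorem dist_toLp_sq (X Y : Fin n → ℝ) :
    dist (WithLp.toLp 2 X : EuclideanSpace ℝ (Fin n)) (WithLp.toLp 2 Y) ^ 2
      = (X - Y) ⬝ᵥ (X - Y) := by
  rw [EuclideanSpace.dist_eq, Real.sq_sqrt (Finset.sum_nonneg fun _ _ => sq_nonneg _)]
  simp [dotProduct, Real.dist_eq, pow_two]

theorem sqDist_le {M : Set (Fin n → ℝ)} {X z : Fin n → ℝ} (hz : z ∈ M) :
    sqDist M X ≤ (X - z) ⬝ᵥ (X - z) := by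
  rw [← dist_toLp_sq]
  exact pow_le_pow_left₀ Metric.infDist_nonneg
    (Metric.infDist_le_dist_of_mem (by simpa using hz)) 2

theorem exists_sqDist_eq {M : Set (Fin n → ℝ)} (hM : IsClosed M) (hne : M.Nonempty)
    (X : Fin n → ℝ) : ∃ y ∈ M, sqDist M X = (X - y) ⬝ᵥ (X - y) := by
  have hcl : IsClosed (WithLp.ofLp ⁻¹' M : Set (EuclideanSpace ℝ (Fin n))) :=
    hM.preimage (PiLp.continuous_ofLp 2 _)
  obtain ⟨z, hz⟩ := hne
  obtain ⟨y, hy, h⟩ := hcl.exists_infDist_eq_dist ⟨WithLp.toLp 2 z, by simpa using hz⟩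
    (WithLp.toLp 2 X)
  refine ⟨y.ofLp, hy, ?_⟩
  rw [sqDist, h, ← dist_toLp_sq]

theorem mem_of_sqDist_eq_zero {M : Set (Fin n → ℝ)} (hM : IsClosed M) (hne : M.Nonempty)
    {X : Fin n → ℝ} (h : sqDist M X = 0) : X ∈ M := by
  obtain ⟨y, hy, h'⟩ := exists_sqDist_eq hM hne X
  rw [h, eq_comm, dotProduct_self_eq_zero, sub_eq_zero] at h'
  rwa [h']

theorem sqDist_eq_zero {M : Set (Fin n → ℝ)} {X : Fin n → ℝ} (h : X ∈ M) : sqDist M X = 0 :=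
  le_antisymm (by simpa using sqDist_le (X := X) h) (sqDist_nonneg _ _)

/-- A linear functional may be prescribed freely on a basis of the span and then extended to the
whole space. Applied to the active gradients, this yields a strictly inward direction. -/
theorem exists_dotProduct_eq_neg_one {ι : Type*} {v : ι → Fin n → ℝ}
    (h : LinearIndependent ℝ v) : ∃ e : Fin n → ℝ, ∀ i, v i ⬝ᵥ e = -1 := by
  obtain ⟨φ, hφ⟩ := LinearMap.exists_extend
    ((Module.Basis.span h).constr ℝ (fun _ => (-1 : ℝ)))
  refine ⟨fun j => φ (Pi.single j 1), fun i => ?_⟩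
  have h1 : φ (v i) = -1 := by
    have := congrArg (fun L => L (Module.Basis.span h i)) hφ
    simp only [LinearMap.comp_apply, Module.Basis.constr_basis] at this
    simpa [Module.Basis.span_apply] using this
  rw [← h1, LinearMap.pi_apply_eq_sum_univ φ (v i)]
  simp only [dotProduct, smul_eq_mul]
  refine Finset.sum_congr rfl fun j _ => ?_
  congr 2
  ext l
  simp [Pi.single_apply, eq_comm]

theorem fderiv_eq_grad_dotProduct (η : (Fin n → ℝ) → ℝ) (y d : Fin n → ℝ) :
    fderiv ℝ η y d = grad η y ⬝ᵥ d := by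
  rw [← ContinuousLinearMap.coe_coe, LinearMap.pi_apply_eq_sum_univ _ d]
  simp only [dotProduct, grad, smul_eq_mul, ContinuousLinearMap.coe_coe]
  refine Finset.sum_congr rfl fun j _ => ?_
  rw [mul_comm]
  congr 2
  ext l
  simp [Pi.single_apply, eq_comm]

/-- Strictly inward directions stay in the sublevel set for a short time. -/
theorem eventually_mem_of_grad_neg {η : Fin m → (Fin n → ℝ) → ℝ} (hη : ∀ i, ContDiff ℝ 1 (η i))
    {y d : Fin n → ℝ} (hy : ∀ i, η i y ≤ 0) (hd : ∀ i, η i y = 0 → grad (η i) y ⬝ᵥ d < 0) :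
    ∀ᶠ h : ℝ in 𝓝[>] 0, ∀ i, η i (y + h • d) ≤ 0 := by
  rw [eventually_all]
  intro i
  have hline : HasDerivAt (fun h : ℝ => y + h • d) d 0 := by
    simpa using ((hasDerivAt_id (0 : ℝ)).smul_const d).const_add y
  rcases (hy i).lt_or_eq with hlt | heq
  · have hc : ContinuousAt (fun h : ℝ => η i (y + h • d)) 0 :=
      ((hη i).continuous.continuousAt).comp hline.continuousAt
    have := hc.eventually_lt_const (u := 0) (by simpa using hlt)
    exact (this.filter_mono nhdsWithin_le_nhds).mono fun _ h => h.le
  · have hdiff : HasFDerivAt (η i) (fderiv ℝ (η i) y) (y + (0 : ℝ) • d) := by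
      simpa using ((hη i).differentiable one_ne_zero y).hasFDerivAt
    have hder : HasDerivAt (fun h : ℝ => η i (y + h • d)) (grad (η i) y ⬝ᵥ d) 0 := by
      rw [← fderiv_eq_grad_dotProduct]
      exact hdiff.comp_hasDerivAt 0 hline
    have hs := hder.tendsto_slope_zero_right
    have := hs.eventually_lt_const (hd i heq)
    filter_upwards [this, self_mem_nhdsWithin] with h h1 h2
    simp only [zero_add, zero_smul, add_zero, heq, sub_zero, smul_eq_mul] at h1
    have h2' : (0 : ℝ) < h := h2
    by_contra hcon
    push Not at hcon
    have : 0 < h⁻¹ * η i (y + h • d) := by positivity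
    linarith

/-- First-order optimality of the nearest point: expand the square of `X - (y + h • d)`, which is at
least the minimum, divide by `h` and let `h → 0`. -/
theorem dotProduct_nonpos_of_eventually_mem {M : Set (Fin n → ℝ)} {X y d : Fin n → ℝ}
    (hmin : sqDist M X = (X - y) ⬝ᵥ (X - y)) (h : ∀ᶠ h : ℝ in 𝓝[>] 0, y + h • d ∈ M) :
    (X - y) ⬝ᵥ d ≤ 0 := by
  have hev : ∀ᶠ h : ℝ in 𝓝[>] 0, 2 * ((X - y) ⬝ᵥ d) ≤ h * (d ⬝ᵥ d) := by
    filter_upwards [h, self_mem_nhdsWithin] with h h1 h2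
    have h2' : (0 : ℝ) < h := h2
    have h3 := sqDist_le (X := X) h1
    have h4 : (X - (y + h • d)) ⬝ᵥ (X - (y + h • d))
        = (X - y) ⬝ᵥ (X - y) - h * (2 * ((X - y) ⬝ᵥ d)) + h * (h * (d ⬝ᵥ d)) := by
      rw [← sub_sub]
      generalize X - y = u
      rw [sub_dotProduct, dotProduct_sub, dotProduct_sub, smul_dotProduct,
        smul_dotProduct, dotProduct_smul, dotProduct_smul, dotProduct_comm d u]
      simp only [smul_eq_mul]
      ring
    rw [hmin, h4] at h3
    have : h * (2 * ((X - y) ⬝ᵥ d)) ≤ h * (h * (d ⬝ᵥ d)) := by linarith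
    exact le_of_mul_le_mul_left this h2'
  have hlim : Tendsto (fun h : ℝ => h * (d ⬝ᵥ d)) (𝓝[>] 0) (𝓝 0) := by
    have : Tendsto (fun h : ℝ => h * (d ⬝ᵥ d)) (𝓝 0) (𝓝 (0 * (d ⬝ᵥ d))) :=
      tendsto_id.mul_const _
    rw [zero_mul] at this
    exact this.mono_left nhdsWithin_le_nhds
  have := ge_of_tendsto hlim hev
  linarith

/-- A projection onto `M` of a point outside of `M` lies on the boundary of `M`. -/
theorem mem_frontier_of_sqDist_eq {M : Set (Fin n → ℝ)} (hM : IsClosed M) {X y : Fin n → ℝ}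
    (hy : y ∈ M) (hmin : sqDist M X = (X - y) ⬝ᵥ (X - y)) (hpos : 0 < sqDist M X) :
    y ∈ frontier M := by
  rw [hM.frontier_eq]
  refine ⟨hy, fun hint => ?_⟩
  have hc : Tendsto (fun h : ℝ => y + h • (X - y)) (𝓝[>] 0) (𝓝 y) := by
    have : Continuous (fun h : ℝ => y + h • (X - y)) := by fun_prop
    simpa using (this.tendsto 0).mono_left nhdsWithin_le_nhds
  -- At an interior point even the direction `X - y` is admissible, which would force `(X - y) ⬝ᵥ (X
  -- - y) ≤ 0`.
  have := dotProduct_nonpos_of_eventually_mem hmin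
    (hc.eventually (mem_interior_iff_mem_nhds.1 hint))
  linarith

/-- If the active gradients at the projection `y` of `X` are linearly independent, then `X - y`
makes an obtuse angle with all linearized feasible directions. -/
theorem dotProduct_nonpos_of_grad_nonpos {η : Fin m → (Fin n → ℝ) → ℝ}
    (hη : ∀ i, ContDiff ℝ 1 (η i)) {M : Set (Fin n → ℝ)} (hM : M = {x | ∀ i, η i x ≤ 0})
    {X y : Fin n → ℝ} (hy : y ∈ M) (hmin : sqDist M X = (X - y) ⬝ᵥ (X - y))
    (hind : LinearIndependent ℝ (fun i : {i // η i y = 0} => grad (η i) y))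
    {B : Fin n → ℝ} (hB : ∀ i, η i y = 0 → grad (η i) y ⬝ᵥ B ≤ 0) :
    (X - y) ⬝ᵥ B ≤ 0 := by
  obtain ⟨e, he⟩ := exists_dotProduct_eq_neg_one hind
  -- `B` is only weakly feasible, so its ray may leave `M`. The perturbation `B + ε • e` strictly
  -- decreases every active constraint, and `ε → 0` recovers `B`.
  have key : ∀ ε : ℝ, 0 < ε → (X - y) ⬝ᵥ B + ε * ((X - y) ⬝ᵥ e) ≤ 0 := by
    intro ε hε
    have h1 := eventually_mem_of_grad_neg hη (y := y) (d := B + ε • e)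
      (by rw [hM] at hy; exact hy) (fun i hi => by
        rw [dotProduct_add, dotProduct_smul, he ⟨i, hi⟩, smul_eq_mul]
        linarith [hB i hi])
    have h2 := dotProduct_nonpos_of_eventually_mem (M := M) hmin (by
      filter_upwards [h1] with h h3
      rw [hM]; exact h3)
    rwa [dotProduct_add, dotProduct_smul, smul_eq_mul] at h2
  have hlim : Tendsto (fun ε : ℝ => (X - y) ⬝ᵥ B + ε * ((X - y) ⬝ᵥ e)) (𝓝[>] 0)
      (𝓝 ((X - y) ⬝ᵥ B)) := by
    have : Continuous (fun ε : ℝ => (X - y) ⬝ᵥ B + ε * ((X - y) ⬝ᵥ e)) := by fun_prop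
    simpa using (this.tendsto 0).mono_left nhdsWithin_le_nhds
  exact le_of_tendsto hlim (by
    filter_upwards [self_mem_nhdsWithin] with ε hε
    exact key ε hε)

/-- Growth of the squared distance to `M` under a small increment `Δ` of `X` which is close to a
linearized feasible increment `B` at a projection `y` of `X`. -/
theorem exists_sqDist_add_le {η : Fin m → (Fin n → ℝ) → ℝ}
    (hη : ∀ i, ContDiff ℝ 1 (η i)) {M : Set (Fin n → ℝ)} (hM : M = {x | ∀ i, η i x ≤ 0})
    (hcl : IsClosed M) (hne : M.Nonempty)
    (hind : ∀ x ∈ frontier M, LinearIndependent ℝ (fun i : {i // η i x = 0} => grad (η i) x))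
    {κ : ℝ} (hκ : 0 ≤ κ) {X : Fin n → ℝ} (hX : 0 < sqDist M X) :
    ∃ y ∈ frontier M, ∃ R, 0 < R ∧ ‖X - y‖ < R ∧ ∀ C : ℝ, 0 ≤ C → ∃ δ > 0, ∀ ρ, 0 ≤ ρ → ρ ≤ δ →
      ∀ Δ B : Fin n → ℝ, (∀ j, |Δ j - B j| ≤ κ * R * ρ) → (∀ j, |B j| ≤ C * ρ) →
        (∀ i, η i y = 0 → grad (η i) y ⬝ᵥ B ≤ 0) →
        sqDist M (X + Δ) ≤ sqDist M X * Real.exp (n * (4 * κ + 1) * ρ) := by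
  obtain ⟨y, hy, hmin⟩ := exists_sqDist_eq hcl hne X
  have hyf := mem_frontier_of_sqDist_eq hcl hy hmin hX
  set E := sqDist M X with hE
  set d := Real.sqrt E with hd
  have hd0 : 0 < d := Real.sqrt_pos.2 hX
  have hdE : d ^ 2 = E := Real.sq_sqrt hX.le
  have hcoord : ∀ j, |(X - y) j| ≤ d := by
    intro j
    apply Real.abs_le_sqrt
    rw [hmin, pow_two]
    exact Finset.single_le_sum (f := fun j => (X - y) j * (X - y) j)
      (fun _ _ => mul_self_nonneg _) (Finset.mem_univ j)
  -- The distance from `X` to `y` is at most `d`; the factor 2 makes the inequality strict, so that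
  -- nearby points of a trajectory also stay within `R` of `y`.
  refine ⟨y, hyf, 2 * d, by positivity, ?_, fun C hC => ?_⟩
  · refine lt_of_le_of_lt ((pi_norm_le_iff_of_nonneg hd0.le).2 hcoord) (by linarith)
  -- Each `|Δ j|` is at most `(2κd + C) ρ`. This `δ` turns one factor `ρ` of its square into `E`, so
  -- the quadratic term becomes linear in `ρ` and proportional to `E`.
  refine ⟨E / ((2 * κ * d + C) ^ 2 + 1), by positivity, fun ρ hρ hρδ Δ B hΔ hB hgrad => ?_⟩
  have hfeas := dotProduct_nonpos_of_grad_nonpos hη hM hy hmin (hind y hyf) hgrad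
  have hsplit : (X + Δ - y) ⬝ᵥ (X + Δ - y)
      = E + 2 * ((X - y) ⬝ᵥ (Δ - B)) + 2 * ((X - y) ⬝ᵥ B) + Δ ⬝ᵥ Δ := by
    have : X + Δ - y = (X - y) + Δ := by abel
    rw [this, hmin]
    generalize X - y = u
    rw [dotProduct_sub, add_dotProduct, dotProduct_add, dotProduct_add, dotProduct_comm Δ u]
    ring
  have h1 : (X - y) ⬝ᵥ (Δ - B) ≤ n * (2 * κ * E * ρ) := by
    have : ∀ j ∈ Finset.univ, (X - y) j * (Δ - B) j ≤ 2 * κ * E * ρ := by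
      intro j _
      calc (X - y) j * (Δ - B) j ≤ |(X - y) j * (Δ - B) j| := le_abs_self _
        _ = |(X - y) j| * |Δ j - B j| := by rw [abs_mul]; rfl
        _ ≤ d * (κ * (2 * d) * ρ) :=
          mul_le_mul (hcoord j) (hΔ j) (abs_nonneg _) hd0.le
        _ = 2 * κ * E * ρ := by rw [← hdE]; ring
    calc (X - y) ⬝ᵥ (Δ - B) ≤ ∑ _j : Fin n, 2 * κ * E * ρ := Finset.sum_le_sum this
      _ = n * (2 * κ * E * ρ) := by simp
  have h2 : Δ ⬝ᵥ Δ ≤ n * (E * ρ) := by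
    have hsmall : (2 * κ * d + C) ^ 2 * ρ ≤ E := by
      have := (le_div_iff₀ (by positivity)).1 hρδ
      nlinarith
    have : ∀ j ∈ Finset.univ, Δ j * Δ j ≤ E * ρ := by
      intro j _
      have hj : |Δ j| ≤ (2 * κ * d + C) * ρ := by
        calc |Δ j| = |(Δ j - B j) + B j| := by ring_nf
          _ ≤ |Δ j - B j| + |B j| := abs_add_le _ _
          _ ≤ κ * (2 * d) * ρ + C * ρ := add_le_add (hΔ j) (hB j)
          _ = _ := by ring
      calc Δ j * Δ j = |Δ j| * |Δ j| := (abs_mul_abs_self _).symm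
        _ ≤ ((2 * κ * d + C) * ρ) * ((2 * κ * d + C) * ρ) :=
          mul_le_mul hj hj (abs_nonneg _) (by positivity)
        _ = ((2 * κ * d + C) ^ 2 * ρ) * ρ := by ring
        _ ≤ E * ρ := by gcongr
    calc Δ ⬝ᵥ Δ ≤ ∑ _j : Fin n, E * ρ := Finset.sum_le_sum this
      _ = n * (E * ρ) := by simp
  -- Relative to `E`, the error `Δ - B` contributes `4nκρ` and the quadratic term `nρ`; the term
  -- with `B` is nonpositive.
  calc sqDist M (X + Δ) ≤ (X + Δ - y) ⬝ᵥ (X + Δ - y) := sqDist_le hy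
    _ ≤ E * (n * (4 * κ + 1) * ρ + 1) := by rw [hsplit]; linarith
    _ ≤ E * Real.exp (n * (4 * κ + 1) * ρ) := by
      gcongr
      exact Real.add_one_le_exp _

end Geometry

/-! ### Real analysis -/

section Analysis

/-- Continuous induction for a left-continuous function and a monotone barrier. -/
theorem le_of_forall_eventually_le {e β : ℝ → ℝ} {a b : ℝ} (hβ : MonotoneOn β (Icc a b))
    (he : ∀ t ∈ Ioc a b, Tendsto e (𝓝[<] t) (𝓝 (e t))) (ha : e a ≤ β a)
    (hstep : ∀ t ∈ Ico a b, e t ≤ β t → ∀ᶠ t' in 𝓝[>] t, t' < b → e t' ≤ β t') :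
    ∀ t ∈ Icc a b, e t ≤ β t := by
  -- The half-open interval makes `s` closed without any regularity of `e`. Left continuity is
  -- needed only to recover the endpoint, in `hleft`.
  set s : Set ℝ := {t | ∀ r ∈ Ico a t, e r ≤ β r}
  have hleft : ∀ t ∈ Icc a b, t ∈ s → e t ≤ β t := by
    intro t ht hts
    rcases ht.1.eq_or_lt with rfl | hat
    · exact ha
    · refine le_of_tendsto (he t ⟨hat, ht.2⟩) ?_
      filter_upwards [Ioo_mem_nhdsLT hat] with r hr
      exact (hts r ⟨hr.1.le, hr.2⟩).trans (hβ ⟨hr.1.le, hr.2.le.trans ht.2⟩ ht hr.2.le)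
  have hclosed : IsClosed s := by
    rw [← isOpen_compl_iff, isOpen_iff_mem_nhds]
    intro t ht
    simp only [s, mem_compl_iff, mem_ofPred_eq, not_forall] at ht
    obtain ⟨r, hr, hre⟩ := ht
    filter_upwards [Ioi_mem_nhds hr.2] with t' ht' hs
    exact hre (hs r ⟨hr.1, ht'⟩)
  have hsub : Icc a b ⊆ s := by
    refine (hclosed.inter isClosed_Icc).Icc_subset_of_forall_exists_gt
      (fun r hr => absurd hr.2 (not_lt.2 hr.1)) ?_
    rintro t ⟨hts, ht⟩ z hz
    have het := hleft t ⟨ht.1, ht.2.le⟩ hts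
    obtain ⟨u, hu, hsub⟩ := mem_nhdsGT_iff_exists_Ioo_subset.1 (hstep t ht het)
    have htm : t < min (min u z) b := lt_min (lt_min hu hz) ht.2
    refine ⟨min (min u z) b, fun r hr => ?_, htm, (min_le_left _ _).trans (min_le_right _ _)⟩
    rcases lt_trichotomy r t with h | rfl | h
    · exact hts r ⟨hr.1, h⟩
    · exact het
    · exact hsub ⟨h, hr.2.trans_le ((min_le_left _ _).trans (min_le_left _ _))⟩
        (hr.2.trans_le (min_le_right _ _))
  exact fun t ht => hleft t ht (hsub ht)

/-- Immediately to the right of a point with a right limit, the oscillation is below any given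
threshold. Hence the points of oscillation at least `1 / (k + 1)` are isolated from the right among
themselves, and a set with this property is countable. -/
theorem countable_not_continuousAt_of_tendsto_right {W : Set ℝ} {h : ℝ → ℝ}
    (hl : ∀ t ∈ W, ∃ c, Tendsto h (𝓝[>] t) (𝓝 c)) : {t ∈ W | ¬ ContinuousAt h t}.Countable := by
  set A : ℕ → Set ℝ := fun k =>
    {t ∈ W | ¬ ∃ δ > 0, ∀ r, |r - t| < δ → |h r - h t| < 1 / ((k : ℝ) + 1)} with hA
  have hcount : ∀ k, (A k).Countable := by
    intro k
    have : A k ⊆ {x ∈ A k | 𝓝[A k ∩ Ioi x] x = ⊥} := by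
      intro t ht
      refine ⟨ht, ?_⟩
      obtain ⟨c, hc⟩ := hl t ht.1
      have hε : (0 : ℝ) < 1 / ((k : ℝ) + 1) / 2 := by positivity
      obtain ⟨u, hu, hsub⟩ := mem_nhdsGT_iff_exists_Ioo_subset.1
        (hc.eventually (Metric.ball_mem_nhds c hε))
      rw [← empty_mem_iff_bot, mem_nhdsWithin]
      refine ⟨Iio u, isOpen_Iio, hu, ?_⟩
      rintro r ⟨hru, hrA, htr⟩
      refine hrA.2 ⟨min (r - t) (u - r), lt_min (sub_pos.2 htr) (sub_pos.2 hru), fun x hx => ?_⟩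
      have hx1 := lt_of_lt_of_le hx (min_le_left _ _)
      have hx2 := lt_of_lt_of_le hx (min_le_right _ _)
      rw [abs_lt] at hx1 hx2
      have h1 : dist (h x) c < _ := hsub ⟨by linarith, by linarith⟩
      have h2 : dist (h r) c < _ := hsub ⟨htr, hru⟩
      have h3 := dist_triangle_right (h x) (h r) c
      rw [Real.dist_eq] at h3
      linarith
    exact countable_setOfPred_isolated_right_within.mono this
  refine (countable_iUnion hcount).mono ?_
  rintro t ⟨htW, ht⟩
  rw [Metric.continuousAt_iff] at ht
  push Not at ht
  obtain ⟨ε, hε, ht⟩ := ht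
  obtain ⟨k, hk⟩ := exists_nat_one_div_lt hε
  refine mem_iUnion.2 ⟨k, htW, ?_⟩
  rintro ⟨δ, hδ, h1⟩
  obtain ⟨x, hx, hx'⟩ := ht δ hδ
  have := h1 x (by rwa [Real.dist_eq] at hx)
  rw [Real.dist_eq] at hx'
  linarith

theorem aestronglyMeasurable_of_tendsto_right {W : Set ℝ} (hW : MeasurableSet W) {h : ℝ → ℝ}
    (hl : ∀ t ∈ W, ∃ c, Tendsto h (𝓝[>] t) (𝓝 c)) :
    AEStronglyMeasurable h (volume.restrict W) := by
  have hc := countable_not_continuousAt_of_tendsto_right hl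
  set D := {t ∈ W | ¬ ContinuousAt h t}
  have hcont : ContinuousOn h (W \ D) := by
    intro t ht
    refine ContinuousAt.continuousWithinAt ?_
    by_contra hn
    exact ht.2 ⟨ht.1, hn⟩
  have := hcont.aestronglyMeasurable (μ := volume) (hW.diff hc.measurableSet)
  have hae : (W \ D : Set ℝ) =ᵐ[volume] W := sdiff_null_ae_eq_self (hc.measure_zero _)
  rwa [Measure.restrict_congr_set hae] at this

/-- The variation of a primitive is at least the integral of the absolute value. -/
theorem integral_abs_le_eVariationOn {u β : ℝ → ℝ} {a b : ℝ} (hab : a < b)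
    (hβ : ContinuousOn β (Icc a b))
    (hu : ∀ s ∈ Icc a b, u s - u a = ∫ r in a..s, β r) :
    ENNReal.ofReal (∫ r in a..b, |β r|) ≤ eVariationOn u (Icc a b) := by
  by_cases htop : eVariationOn u (Icc a b) = ⊤
  · rw [htop]; exact le_top
  have hloc : LocallyBoundedVariationOn u (Icc a b) :=
    BoundedVariationOn.locallyBoundedVariationOn htop
  have ha : a ∈ Icc a b := left_mem_Icc.2 hab.le
  have hb : b ∈ Icc a b := right_mem_Icc.2 hab.le
  set P := variationOnFromTo u (Icc a b) a
  have hP : MonotoneOn P (Icc a b) := variationOnFromTo.monotoneOn hloc ha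
  have hP' : MonotoneOn P (uIcc a b) := by rwa [uIcc_of_le hab.le]
  have hdiff : ∀ s ∈ Icc a b, ∀ s' ∈ Icc a b, s ≤ s' → |u s' - u s| ≤ P s' - P s := by
    intro s hs s' hs' hss
    have h2 : P s + variationOnFromTo u (Icc a b) s s' = P s' :=
      variationOnFromTo.add hloc ha hs hs'
    have h3 : variationOnFromTo u (Icc a b) s s'
        = (eVariationOn u (Icc a b ∩ Icc s s')).toReal := variationOnFromTo.eq_of_le _ _ hss
    have h4 : |u s' - u s| ≤ (eVariationOn u (Icc a b ∩ Icc s s')).toReal := by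
      have : BoundedVariationOn u (Icc a b ∩ Icc s s') := hloc s s' hs hs'
      simpa [Real.dist_eq] using
        this.dist_le (x := s') (y := s) ⟨hs', hss, le_rfl⟩ ⟨hs, le_rfl, hss⟩
    linarith
  -- Increments of `u` are dominated by those of its variation function `P`. Almost everywhere both
  -- are differentiable, and difference quotients give `|β| ≤ P'`.
  have hle : ∫ r in a..b, |β r| ≤ ∫ r in a..b, deriv P r := by
    refine intervalIntegral.integral_mono_ae_restrict hab.le
      (hβ.abs.intervalIntegrable_of_Icc hab.le) hP'.intervalIntegrable_deriv ?_
    have hae := hP.ae_differentiableWithinAt_of_mem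
    rw [EventuallyLE, ae_restrict_iff' measurableSet_Icc]
    have hne : ∀ᵐ r : ℝ, r ≠ a ∧ r ≠ b := by
      filter_upwards [Measure.ae_ne volume a, Measure.ae_ne volume b] with r h1 h2
      exact ⟨h1, h2⟩
    filter_upwards [hae, hne] with r hr hrne hrI
    have hrIoo : r ∈ Ioo a b :=
      ⟨lt_of_le_of_ne hrI.1 (Ne.symm hrne.1), lt_of_le_of_ne hrI.2 hrne.2⟩
    have hnhds : Icc a b ∈ 𝓝 r := Icc_mem_nhds hrIoo.1 hrIoo.2
    have hPd : HasDerivAt P (deriv P r) r :=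
      ((hr hrI).differentiableAt hnhds).hasDerivAt
    have hud : HasDerivAt u (β r) r := by
      have h1 : HasDerivAt (fun s => ∫ q in a..s, β q) (β r) r :=
        intervalIntegral.integral_hasDerivAt_right
          ((hβ.mono (Icc_subset_Icc_right hrI.2)).intervalIntegrable_of_Icc hrI.1)
          (hβ.stronglyMeasurableAtFilter_nhdsWithin measurableSet_Icc r |>.filter_mono
            (by rw [nhdsWithin_eq_nhds.2 hnhds]))
          (hβ.continuousAt hnhds)
      refine (h1.add_const (u a)).congr_of_eventuallyEq ?_
      filter_upwards [hnhds] with s hs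
      rw [← hu s hs]; ring
    have h5 := hud.tendsto_slope_zero_right.abs
    have h6 := hPd.tendsto_slope_zero_right
    refine le_of_tendsto_of_tendsto h5 h6 ?_
    have : ∀ᶠ t : ℝ in 𝓝[>] 0, r + t ∈ Icc a b := by
      have : Tendsto (fun t : ℝ => r + t) (𝓝[>] 0) (𝓝 r) := by
        have : Continuous (fun t : ℝ => r + t) := by fun_prop
        simpa using (this.tendsto 0).mono_left nhdsWithin_le_nhds
      exact this.eventually hnhds
    filter_upwards [this, self_mem_nhdsWithin] with t ht ht0
    have ht0' : (0 : ℝ) < t := ht0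
    simp only [smul_eq_mul]
    rw [abs_mul, abs_of_pos (inv_pos.2 ht0')]
    exact mul_le_mul_of_nonneg_left (hdiff r hrI _ ht (by linarith)) (inv_pos.2 ht0').le
  -- For a monotone function the integral of the derivative does not exceed the increment; absolute
  -- continuity of `P` is not needed.
  have hmem := hP'.intervalIntegral_deriv_mem_uIcc
  rw [uIcc_of_le (sub_nonneg.2 (hP ha hb hab.le))] at hmem
  have hPa : P a = 0 := variationOnFromTo.self _ _ _
  have hPb : P b = (eVariationOn u (Icc a b)).toReal := by
    have := variationOnFromTo.eq_of_le u (Icc a b) hab.le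
    rwa [inter_self] at this
  refine ENNReal.ofReal_le_of_le_toReal ?_
  rw [← hPb]
  linarith [hmem.2]

theorem boundedVariationOn_sub {f g : ℝ → ℝ} {s : Set ℝ} (hf : BoundedVariationOn f s)
    (hg : BoundedVariationOn g s) : BoundedVariationOn (fun t => f t - g t) s := by
  refine ne_top_of_le_ne_top (ENNReal.add_ne_top.2 ⟨hf, hg⟩) ?_
  refine iSup_le ?_
  rintro ⟨k, u, hu, hus⟩
  calc ∑ i ∈ Finset.range k, edist (f (u (i + 1)) - g (u (i + 1))) (f (u i) - g (u i))
      ≤ ∑ i ∈ Finset.range k, (edist (f (u (i + 1))) (f (u i))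
          + edist (g (u (i + 1))) (g (u i))) := by
        refine Finset.sum_le_sum fun i _ => ?_
        rw [edist_dist, edist_dist, edist_dist, ← ENNReal.ofReal_add dist_nonneg dist_nonneg]
        exact ENNReal.ofReal_le_ofReal (dist_sub_sub_le _ _ _ _)
    _ ≤ eVariationOn f s + eVariationOn g s := by
        rw [Finset.sum_add_distrib]
        exact add_le_add (eVariationOn.sum_le hu hus) (eVariationOn.sum_le hu hus)

/-- Freezing the argument at its limit `z` costs at most `K * ‖ξ p - z‖`, which tends to zero. Thus
coefficients that are only separately regular have limits along trajectories. -/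
theorem tendsto_comp_of_lipschitz {ι E : Type*} [NormedAddCommGroup E] {F : Filter ι}
    {h : ι → E → ℝ} {ξ : ι → E} {z : E} {c K : ℝ}
    (h1 : Tendsto (fun p => h p z) F (𝓝 c)) (h2 : Tendsto ξ F (𝓝 z))
    (h3 : ∀ᶠ p in F, |h p (ξ p) - h p z| ≤ K * ‖ξ p - z‖) :
    Tendsto (fun p => h p (ξ p)) F (𝓝 c) := by
  have h4 : Tendsto (fun p => K * ‖ξ p - z‖) F (𝓝 0) := by
    have := (tendsto_iff_norm_sub_tendsto_zero.1 h2).const_mul K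
    simpa using this
  have h5 : Tendsto (fun p => h p (ξ p) - h p z) F (𝓝 0) :=
    squeeze_zero_norm' (by simpa [Real.norm_eq_abs] using h3) h4
  simpa using h5.add h1

end Analysis

/-! ### Elementary test functions -/

/-- The indicator function of the open interval `(a, b)`, with ordinary values. -/
noncomputable def bump (a b : ℝ) : DynFun := fun t _ => (Ioo a b).indicator (fun _ => 1) t

/-- The test function concentrated at `τ`, with dynamic value the indicator function
of `(a, b]`. -/
noncomputable def spike (τ a b : ℝ) : DynFun :=
  fun t s => if t = τ then (Ioc a b).indicator (fun _ => 1) s else 0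

theorem exists_tendsto_of_eventually_eq {l : Filter ℝ} {h : ℝ → ℝ} {c : ℝ}
    (H : ∀ᶠ t in l, h t = c) : ∃ c, Tendsto h l (𝓝 c) :=
  ⟨c, tendsto_const_nhds.congr' (H.mono fun _ h => h.symm)⟩

/-- An order-connected set either misses some left neighbourhood of `t` or contains one, so its
indicator is eventually constant. -/
theorem exists_tendsto_left_indicator {S : Set ℝ} (hS : S.OrdConnected) (t : ℝ) :
    ∃ c, Tendsto (S.indicator (fun _ => (1 : ℝ))) (𝓝[<] t) (𝓝 c) := by
  by_cases h : ∃ u < t, Ioo u t ∩ S = ∅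
  · obtain ⟨u, hu, he⟩ := h
    refine exists_tendsto_of_eventually_eq (c := 0) ?_
    filter_upwards [Ioo_mem_nhdsLT hu] with r hr
    exact indicator_of_notMem (fun hrS => (he ▸ (⟨hr, hrS⟩ : r ∈ Ioo u t ∩ S) : r ∈ (∅ : Set ℝ))) _
  · push Not at h
    obtain ⟨u, hu⟩ := h (t - 1) (by linarith)
    refine exists_tendsto_of_eventually_eq (c := 1) ?_
    filter_upwards [Ioo_mem_nhdsLT hu.1.2] with r hr
    obtain ⟨v, hv⟩ := h r hr.2
    exact indicator_of_mem (hS.out hu.2 hv.2 ⟨hr.1.le, hv.1.1.le⟩) _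

theorem exists_tendsto_right_indicator {S : Set ℝ} (hS : S.OrdConnected) (t : ℝ) :
    ∃ c, Tendsto (S.indicator (fun _ => (1 : ℝ))) (𝓝[>] t) (𝓝 c) := by
  by_cases h : ∃ u > t, Ioo t u ∩ S = ∅
  · obtain ⟨u, hu, he⟩ := h
    refine exists_tendsto_of_eventually_eq (c := 0) ?_
    filter_upwards [Ioo_mem_nhdsGT hu] with r hr
    exact indicator_of_notMem (fun hrS => (he ▸ (⟨hr, hrS⟩ : r ∈ Ioo t u ∩ S) : r ∈ (∅ : Set ℝ))) _
  · push Not at h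
    obtain ⟨u, hu⟩ := h (t + 1) (by linarith)
    refine exists_tendsto_of_eventually_eq (c := 1) ?_
    filter_upwards [Ioo_mem_nhdsGT hu.1.1] with r hr
    obtain ⟨v, hv⟩ := h r hr.1
    exact indicator_of_mem (hS.out hv.2 hu.2 ⟨hv.1.2.le, hr.2.le⟩) _

theorem isRegulatedJ_const (c : ℝ) : IsRegulatedJ (fun _ => c) :=
  ⟨⟨|c|, fun _ _ => le_rfl⟩, fun _ _ => ⟨c, tendsto_const_nhds⟩, fun _ _ => ⟨c, tendsto_const_nhds⟩⟩

theorem isTestOn_bump (a b : ℝ) : IsTestOn a b (bump a b) where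
  values _ := isRegulatedJ_const _
  left t := by
    obtain ⟨c, hc⟩ := exists_tendsto_left_indicator (ordConnected_Ioo (a := a) (b := b)) t
    exact ⟨c, hc.comp tendsto_fst⟩
  right t := by
    obtain ⟨c, hc⟩ := exists_tendsto_right_indicator (ordConnected_Ioo (a := a) (b := b)) t
    exact ⟨c, hc.comp tendsto_fst⟩
  support t ht s _ := indicator_of_notMem (fun h => ht (Ioo_subset_Icc_self h)) _

theorem spike_of_ne {τ t : ℝ} (h : t ≠ τ) (a b s : ℝ) : spike τ a b t s = 0 := by
  simp [spike, h]

theorem spike_self (τ a b s : ℝ) : spike τ a b τ s = (Ioc a b).indicator (fun _ => 1) s := by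
  simp [spike]

theorem isTestOn_spike (τ a b : ℝ) : IsTestOn τ τ (spike τ a b) where
  values t := by
    by_cases h : t = τ
    · have : spike τ a b t = (Ioc a b).indicator (fun _ => 1) := by
        ext s; rw [h, spike_self]
      rw [this]
      refine ⟨⟨1, fun s _ => ?_⟩, fun s _ => exists_tendsto_right_indicator ordConnected_Ioc s,
        fun s _ => exists_tendsto_left_indicator ordConnected_Ioc s⟩
      by_cases hs : s ∈ Ioc a b <;> simp [hs]
    · have : spike τ a b t = fun _ => 0 := by
        ext s; rw [spike_of_ne h]
      rw [this]
      exact isRegulatedJ_const 0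
  left t := by
    refine ⟨0, tendsto_const_nhds.congr' ?_⟩
    rw [EventuallyEq, eventually_prod_principal_iff]
    by_cases h : t ≤ τ
    · filter_upwards [self_mem_nhdsWithin] with r hr s _
      exact (spike_of_ne (ne_of_lt (lt_of_lt_of_le hr h)) _ _ _).symm
    · filter_upwards [Ioo_mem_nhdsLT (not_le.1 h)] with r hr s _
      exact (spike_of_ne hr.1.ne' _ _ _).symm
  right t := by
    refine ⟨0, tendsto_const_nhds.congr' ?_⟩
    rw [EventuallyEq, eventually_prod_principal_iff]
    by_cases h : τ ≤ t
    · filter_upwards [self_mem_nhdsWithin] with r hr s _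
      exact (spike_of_ne (ne_of_gt (lt_of_le_of_lt h hr)) _ _ _).symm
    · filter_upwards [Ioo_mem_nhdsGT (not_le.1 h)] with r hr s _
      exact (spike_of_ne hr.2.ne _ _ _).symm
  support t ht s _ := spike_of_ne (fun h => ht (by simp [h])) _ _ _

/-- `φ` is measurable with values in `[0, 1]`. -/
structure IsCutoff (φ : DynFun) : Prop where
  nonneg : ∀ t s, 0 ≤ φ t s
  le_one : ∀ t s, φ t s ≤ 1
  measurable_ord : Measurable (fun t => φ t 0)
  measurable_value : ∀ t, Measurable (φ t)

theorem isCutoff_bump (a b : ℝ) : IsCutoff (bump a b) where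
  nonneg _ _ := indicator_nonneg (fun _ _ => zero_le_one) _
  le_one _ _ := indicator_le_self' (fun _ _ => zero_le_one) _
  measurable_ord := measurable_const.indicator measurableSet_Ioo
  measurable_value _ := measurable_const

theorem isCutoff_spike (τ a b : ℝ) : IsCutoff (spike τ a b) where
  nonneg t s := by
    unfold spike; split_ifs
    exacts [indicator_nonneg (fun _ _ => zero_le_one) _, le_rfl]
  le_one t s := by
    unfold spike; split_ifs
    exacts [indicator_le_self' (fun _ _ => zero_le_one) _, zero_le_one]
  measurable_ord := by
    have : (fun t => spike τ a b t 0)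
        = ({τ} : Set ℝ).indicator (fun _ => (Ioc a b).indicator (fun _ => 1) 0) := by
      ext t
      by_cases h : t = τ <;> simp [spike, h]
    rw [this]
    exact measurable_const.indicator (measurableSet_singleton τ)
  measurable_value t := by
    by_cases h : t = τ
    · have : spike τ a b t = (Ioc a b).indicator (fun _ => 1) := by
        ext s; rw [h, spike_self]
      rw [this]
      exact measurable_const.indicator measurableSet_Ioc
    · have : spike τ a b t = fun _ => 0 := by
        ext s; rw [spike_of_ne h]
      rw [this]
      exact measurable_const

theorem integral_mul_indicator_Ioc {h : ℝ → ℝ} {a b p q : ℝ} (hpa : p ≤ a) (hab : a ≤ b)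
    (hbq : b ≤ q) :
    ∫ s in p..q, h s * (Ioc a b).indicator (fun _ => 1) s = ∫ s in a..b, h s := by
  have : (fun s => h s * (Ioc a b).indicator (fun _ => 1) s) = (Ioc a b).indicator h := by
    ext s; by_cases hs : s ∈ Ioc a b <;> simp [hs]
  rw [this, intervalIntegral.integral_of_le (hpa.trans (hab.trans hbq)),
    intervalIntegral.integral_of_le hab, integral_indicator measurableSet_Ioc,
    Measure.restrict_restrict measurableSet_Ioc,
    inter_eq_left.2 (Ioc_subset_Ioc hpa hbq)]

theorem integral_mul_ord_spike (h : ℝ → ℝ) (τ a b : ℝ) :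
    ∫ t, h t * spike τ a b t 0 = 0 := by
  have : (fun t => h t * spike τ a b t 0) =ᵐ[volume] 0 := by
    filter_upwards [Measure.ae_ne volume τ] with t ht
    simp [spike_of_ne ht]
  rw [integral_congr_ae this]; simp

/-! ### The derivative on elementary test functions -/

theorem jordan_integral_indicator (μ : SignedMeasure ℝ) {A : Set ℝ} (hA : MeasurableSet A)
    (v : ℝ) :
    (∫ t, A.indicator (fun _ => v) t ∂μ.toJordanDecomposition.posPart)
      - ∫ t, A.indicator (fun _ => v) t ∂μ.toJordanDecomposition.negPart = v * μ A := by
  have h : μ A = μ.toJordanDecomposition.posPart.real A - μ.toJordanDecomposition.negPart.real A := by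
    conv_lhs => rw [← μ.toSignedMeasure_toJordanDecomposition]
    simp [JordanDecomposition.toSignedMeasure, Measure.toSignedMeasure_apply_measurable hA]
  rw [integral_indicator_const _ hA, integral_indicator_const _ hA, h]
  simp only [smul_eq_mul]
  ring

theorem stieltjesIntegral_eq {p q v : ℝ} {A : Set ℝ} (hA : MeasurableSet A) {F : ℝ → ℝ}
    (hF : BoundedVariationOn (fun t => F (max p (min t q))) univ) :
    stieltjesIntegral p q (A.indicator (fun _ => v)) F = v * hF.vectorMeasure A := by
  unfold stieltjesIntegral
  rw [dif_pos hF]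
  exact jordan_integral_indicator _ hA v

theorem IsSG.continuousOn {S : Set ℝ} {f : DynFun} (h : IsSG S f) {t : ℝ} (ht : t ∈ S) :
    ContinuousOn (f t) J := by
  have := (h.absCont t ht).continuousOn
  rwa [uIcc_of_le (by norm_num)] at this

theorem eq_of_notMem_dynPts {f : DynFun} {t s s' : ℝ} (ht : t ∉ dynPts f) (hs : s ∈ J)
    (hs' : s' ∈ J) : f t s = f t s' := by
  simp only [dynPts, mem_ofPred_eq, not_exists, not_and, not_not] at ht
  rw [ht s hs, ht s' hs']

theorem left_mem_J : (-1 / 2 : ℝ) ∈ J := by constructor <;> norm_num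

theorem right_mem_J : (1 / 2 : ℝ) ∈ J := by constructor <;> norm_num

theorem zero_mem_J : (0 : ℝ) ∈ J := by constructor <;> norm_num

theorem HasLeftLim.tendsto_value {f : DynFun} {t c s : ℝ} (h : HasLeftLim f t c) (hs : s ∈ J) :
    Tendsto (fun r => f r s) (𝓝[<] t) (𝓝 c) := by
  refine Tendsto.comp h (tendsto_id.prodMk ?_)
  exact tendsto_principal.2 (Eventually.of_forall fun _ => hs)

theorem HasRightLim.tendsto_value {f : DynFun} {t c s : ℝ} (h : HasRightLim f t c) (hs : s ∈ J) :
    Tendsto (fun r => f r s) (𝓝[>] t) (𝓝 c) := by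
  refine Tendsto.comp h (tendsto_id.prodMk ?_)
  exact tendsto_principal.2 (Eventually.of_forall fun _ => hs)

/-- The value of the derivative on a test function concentrated at one point is the increment of
the dynamic value. -/
theorem derivOn_spike {S : Set ℝ} {f : DynFun} (hf : IsSG S f) {τ a b : ℝ} (hτ : τ ∈ S)
    (ha : -1 / 2 ≤ a) (hab : a ≤ b) (hb : b ≤ 1 / 2) :
    derivOn τ τ f (spike τ a b) = f τ b - f τ a := by
  have hord : ord (spike τ a b)
      = ({τ} : Set ℝ).indicator (fun _ => (Ioc a b).indicator (fun _ => 1) 0) := by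
    ext t
    by_cases h : t = τ <;> simp [ord, spike, h]
  -- Clamping to the degenerate interval `[τ, τ]` leaves a constant, so the Stieltjes part vanishes
  -- and only the dynamic value at `τ` is seen.
  have hconst : (fun t => contPart f τ (max τ (min t τ))) = fun _ => contPart f τ τ := by
    ext t; simp
  have hF : BoundedVariationOn (fun t => contPart f τ (max τ (min t τ))) univ := by
    rw [hconst]
    have : eVariationOn (fun _ : ℝ => contPart f τ τ) univ = 0 :=
      eVariationOn.constant_on (by
        rintro _ ⟨_, _, rfl⟩ _ ⟨_, _, rfl⟩; rfl)
    exact this.trans_ne ENNReal.zero_ne_top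
  have hst : stieltjesIntegral τ τ (ord (spike τ a b)) (contPart f τ) = 0 := by
    rw [hord, stieltjesIntegral_eq (measurableSet_singleton τ) hF, hF.vectorMeasure_singleton,
      leftLim_eq_of_tendsto (y := contPart f τ τ), rightLim_eq_of_tendsto
      (y := contPart f τ τ), sub_self, mul_zero]
    · rw [hconst]; exact tendsto_const_nhds
    · rw [hconst]; exact tendsto_const_nhds
  have hint : ∫ s in (-1 / 2 : ℝ)..(1 / 2), spike τ a b τ s * deriv (f τ) s = f τ b - f τ a := by
    have : (fun s => spike τ a b τ s * deriv (f τ) s)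
        = fun s => deriv (f τ) s * (Ioc a b).indicator (fun _ => 1) s := by
      ext s; rw [spike_self, mul_comm]
    rw [this, integral_mul_indicator_Ioc ha hab hb]
    refine ((hf.absCont τ hτ).mono ?_).integral_deriv_eq_sub
    rw [uIcc_of_le hab, uIcc_of_le (by norm_num)]
    exact Icc_subset_Icc ha hb
  rw [derivOn, hst, zero_add, tsum_subtype (dynPts f ∩ Icc τ τ)
    (fun x => ∫ s in (-1 / 2 : ℝ)..(1 / 2), spike τ a b x s * deriv (f x) s),
    tsum_eq_single τ]
  · by_cases hD : τ ∈ dynPts f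
    · rw [indicator_of_mem (by simpa using hD), hint]
    · rw [indicator_of_notMem (by simpa using hD),
        eq_of_notMem_dynPts hD (s := b) (s' := a) ⟨ha.trans hab, hb⟩ ⟨ha, hab.trans hb⟩, sub_self]
  · intro x hx
    refine indicator_of_notMem (fun h => hx ?_) _
    have := h.2
    rwa [Icc_self] at this

/-- The jump of `f` at `t`. -/
noncomputable def jump (f : DynFun) (t : ℝ) : ℝ := f t (1 / 2) - f t (-1 / 2)

theorem jump_eq_zero {f : DynFun} {t : ℝ} (ht : t ∉ dynPts f) : jump f t = 0 :=
  sub_eq_zero.2 (eq_of_notMem_dynPts ht right_mem_J left_mem_J)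

theorem indicator_dynPts_inter_jump (f : DynFun) (A : Set ℝ) :
    (dynPts f ∩ A).indicator (jump f) = A.indicator (jump f) := by
  ext t
  by_cases h : t ∈ A
  · by_cases ht : t ∈ dynPts f
    · rw [indicator_of_mem h, indicator_of_mem (mem_inter ht h)]
    · rw [indicator_of_mem h, indicator_of_notMem (fun h : t ∈ dynPts f ∩ A => ht h.1),
        jump_eq_zero ht]
  · rw [indicator_of_notMem h, indicator_of_notMem (fun h' : t ∈ dynPts f ∩ A => h h'.2)]

theorem summable_jump {S : Set ℝ} {f : DynFun} (hf : IsSBVLoc S f) {a b : ℝ}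
    (hab : Icc a b ⊆ S) : Summable ((Icc a b).indicator (jump f)) := by
  have hfin := ENNReal.summable_toReal (hf.dynBV a b hab)
  have h1 : Summable (fun τ : (dynPts f ∩ Icc a b : Set ℝ) => jump f τ) := by
    refine Summable.of_norm_bounded hfin fun τ => ?_
    have hne : BoundedVariationOn (f τ) J :=
      ENNReal.ne_top_of_tsum_ne_top (hf.dynBV a b hab) τ
    have := hne.dist_le right_mem_J left_mem_J
    rwa [Real.dist_eq] at this
  have h2 : Summable ((dynPts f ∩ Icc a b).indicator (jump f)) :=
    summable_subtype_iff_indicator.1 h1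
  rwa [indicator_dynPts_inter_jump] at h2

theorem tsum_dynPts_inter_jump {f : DynFun} {A : Set ℝ} :
    ∑' τ : (dynPts f ∩ A : Set ℝ), (f τ (1 / 2) - f τ (-1 / 2))
      = ∑' τ, A.indicator (jump f) τ := by
  rw [← indicator_dynPts_inter_jump]
  exact tsum_subtype (dynPts f ∩ A) (jump f)

/-- Writing `v = |v| - (|v| - v)` exhibits the function as a difference of two bounded monotone
ones. -/
theorem boundedVariationOn_tsum_indicator {a : ℝ} {v : ℝ → ℝ} (hv : Summable v) :
    BoundedVariationOn (fun t => ∑' τ, (Ico a t).indicator v τ) univ := by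
  have hmono : ∀ w : ℝ → ℝ, Summable w → (∀ τ, 0 ≤ w τ) →
      BoundedVariationOn (fun t => ∑' τ, (Ico a t).indicator w τ) univ := by
    intro w hw hw0
    refine MonotoneOn.boundedVariationOn (C := ∑' τ, w τ) ?_ ?_
    · intro t _ t' _ htt
      refine (hw.indicator _).tsum_le_tsum ?_ (hw.indicator _)
      intro τ
      exact indicator_le_indicator_of_subset (Ico_subset_Ico_right htt) hw0 τ
    · intro t _
      rw [abs_of_nonneg (tsum_nonneg fun τ => indicator_nonneg (fun τ _ => hw0 τ) τ)]
      refine (hw.indicator _).tsum_le_tsum ?_ hw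
      intro τ
      exact indicator_le_self' (fun _ _ => hw0 _) _
  have hp : Summable (fun τ => |v τ|) := hv.abs
  have h1 := hmono (fun τ => |v τ|) hp (fun _ => abs_nonneg _)
  have h2 := hmono (fun τ => |v τ| - v τ) (hp.sub hv) (fun τ => sub_nonneg.2 (le_abs_self _))
  convert boundedVariationOn_sub h1 h2 using 1
  ext t
  rw [← (hp.indicator _).tsum_sub ((hp.sub hv).indicator _)]
  refine tsum_congr fun τ => ?_
  by_cases h : τ ∈ Ico a t <;> simp [h]

theorem tendsto_tsum_indicator_left {a b : ℝ} {v : ℝ → ℝ} (hv : Summable v) :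
    Tendsto (fun t => ∑' τ, (Ico a t).indicator v τ) (𝓝[<] b)
      (𝓝 (∑' τ, (Ico a b).indicator v τ)) := by
  refine tendsto_tsum_of_dominated_convergence hv.abs ?_ ?_
  · intro τ
    refine tendsto_const_nhds.congr' ?_
    by_cases hτ : τ < b
    · filter_upwards [Ioo_mem_nhdsLT hτ] with t ht
      by_cases h : a ≤ τ <;> simp [indicator, h, hτ, ht.1]
    · filter_upwards [self_mem_nhdsWithin] with t ht
      have : ¬ τ < t := fun h => hτ (h.trans ht)
      simp [indicator, hτ, this]
  · refine Eventually.of_forall fun t τ => ?_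
    rw [← Real.norm_eq_abs]
    exact norm_indicator_le_norm_self _ _

/-- As `t` decreases to `a`, the intervals `[a, t)` shrink to `{a}` and not to the empty set, so the
mass at `a` survives. -/
theorem tendsto_tsum_indicator_right {a : ℝ} {v : ℝ → ℝ} (hv : Summable v) :
    Tendsto (fun t => ∑' τ, (Ico a t).indicator v τ) (𝓝[>] a) (𝓝 (v a)) := by
  have hva : v a = ∑' τ, ({a} : Set ℝ).indicator v τ := by
    rw [tsum_eq_single a (fun τ hτ => indicator_of_notMem (by simpa using hτ) _)]
    simp
  rw [hva]
  refine tendsto_tsum_of_dominated_convergence hv.abs ?_ ?_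
  · intro τ
    refine tendsto_const_nhds.congr' ?_
    rcases lt_trichotomy τ a with hτ | rfl | hτ
    · refine Eventually.of_forall fun t => ?_
      simp [indicator, hτ.ne, hτ.not_ge]
    · filter_upwards [self_mem_nhdsWithin] with t ht
      have : τ < t := ht
      simp [indicator, this]
    · filter_upwards [Ioo_mem_nhdsGT hτ] with t ht
      simp [indicator, hτ.ne', ht.2.le]
  · refine Eventually.of_forall fun t τ => ?_
    rw [← Real.norm_eq_abs]
    exact norm_indicator_le_norm_self _ _

/-- The value of the derivative on the indicator function of an open interval is the increment
of the ordinary part between the one-sided limits inside the interval. -/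
theorem derivOn_bump {S : Set ℝ} {f : DynFun} (hf : IsSBVLoc S f) {a b : ℝ} (hab : a < b)
    (hS : Icc a b ⊆ S) : derivOn a b f (bump a b) = f b (-1 / 2) - f a (1 / 2) := by
  have ha : a ∈ S := hS (left_mem_Icc.2 hab.le)
  have hb : b ∈ S := hS (right_mem_Icc.2 hab.le)
  set v : ℝ → ℝ := (Icc a b).indicator (jump f) with hvdef
  have hv : Summable v := summable_jump hf hS
  have hind : ∀ A : Set ℝ, A ⊆ Icc a b → A.indicator (jump f) = A.indicator v := by
    intro A hA
    rw [hvdef, indicator_indicator, inter_eq_left.2 hA]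
  have hcont : ∀ t ∈ Icc a b,
      contPart f a t = f t (-1 / 2) - ∑' τ, (Ico a t).indicator v τ := by
    intro t ht
    rw [contPart, tsum_dynPts_inter_jump,
      hind _ (Ico_subset_Icc_self.trans (Icc_subset_Icc_right ht.2))]
  have hclamp : ∀ t, max a (min t b) ∈ Icc a b :=
    fun t => ⟨le_max_left _ _, max_le hab.le (min_le_right _ _)⟩
  have hmon : Monotone (fun t => max a (min t b)) := fun t t' h => by
    dsimp only; gcongr
  have heq : (fun t => contPart f a (max a (min t b))) = fun t =>
      f (max a (min t b)) (-1 / 2) - ∑' τ, (Ico a (max a (min t b))).indicator v τ := by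
    ext t; exact hcont _ (hclamp t)
  have hF : BoundedVariationOn (fun t => contPart f a (max a (min t b))) univ := by
    rw [heq]
    refine boundedVariationOn_sub ?_ ?_
    · have h1 : BoundedVariationOn (fun t => f t (-1 / 2)) (S ∩ Icc a b) := hf.ordBV a b ha hb
      refine ne_top_of_le_ne_top h1 ?_
      exact eVariationOn.comp_le_of_monotoneOn (fun t => f t (-1 / 2)) _ (hmon.monotoneOn _)
        (fun t _ => ⟨hS (hclamp t), hclamp t⟩)
    · refine ne_top_of_le_ne_top (boundedVariationOn_tsum_indicator (a := a) hv) ?_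
      exact eVariationOn.comp_le_of_monotoneOn (fun t => ∑' τ, (Ico a t).indicator v τ) _
        (hmon.monotoneOn _) (fun t _ => mem_univ _)
  have hin : ∀ t ∈ Ioo a b, contPart f a (max a (min t b))
      = f t (-1 / 2) - ∑' τ, (Ico a t).indicator v τ := by
    intro t ht
    rw [min_eq_left ht.2.le, max_eq_right ht.1.le, hcont t (Ioo_subset_Icc_self ht)]
  have hL : Tendsto (fun t => contPart f a (max a (min t b))) (𝓝[<] b)
      (𝓝 (f b (-1 / 2) - ∑' τ, (Ico a b).indicator v τ)) := by
    refine (((hf.isSG.left b hb).tendsto_value left_mem_J).sub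
      (tendsto_tsum_indicator_left hv)).congr' ?_
    filter_upwards [Ioo_mem_nhdsLT hab] with t ht
    exact (hin t ht).symm
  have hR : Tendsto (fun t => contPart f a (max a (min t b))) (𝓝[>] a)
      (𝓝 (f a (1 / 2) - v a)) := by
    refine (((hf.isSG.right a ha).tendsto_value left_mem_J).sub
      (tendsto_tsum_indicator_right hv)).congr' ?_
    filter_upwards [Ioo_mem_nhdsGT hab] with t ht
    exact (hin t ht).symm
  -- The measure of an open interval is the difference of the inner one-sided limits. Compared with
  -- the increment of `f`, it lacks exactly the jumps inside `(a, b)`, which the sum over dynamic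
  -- values restores.
  have hst : stieltjesIntegral a b (ord (bump a b)) (contPart f a)
      = (f b (-1 / 2) - ∑' τ, (Ico a b).indicator v τ) - (f a (1 / 2) - v a) := by
    have : ord (bump a b) = (Ioo a b).indicator (fun _ => (1 : ℝ)) := rfl
    rw [this, stieltjesIntegral_eq measurableSet_Ioo hF, one_mul, hF.vectorMeasure_Ioo hab,
      leftLim_eq_of_tendsto hL, rightLim_eq_of_tendsto hR]
  have hsum : ∑' τ : (dynPts f ∩ Icc a b : Set ℝ),
      ∫ s in (-1 / 2 : ℝ)..(1 / 2), bump a b τ s * deriv (f τ) s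
        = ∑' τ, (Ioo a b).indicator v τ := by
    rw [← hind _ Ioo_subset_Icc_self, ← tsum_dynPts_inter_jump,
      tsum_subtype (dynPts f ∩ Icc a b)
        (fun τ => ∫ s in (-1 / 2 : ℝ)..(1 / 2), bump a b τ s * deriv (f τ) s),
      tsum_subtype (dynPts f ∩ Ioo a b) (fun τ => f τ (1 / 2) - f τ (-1 / 2))]
    refine tsum_congr fun t => ?_
    by_cases ht : t ∈ Ioo a b
    · by_cases hD : t ∈ dynPts f
      · rw [indicator_of_mem (mem_inter hD (Ioo_subset_Icc_self ht)),
          indicator_of_mem (mem_inter hD ht)]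
        simp only [bump, indicator_of_mem ht, one_mul]
        exact (hf.isSG.absCont t (hS (Ioo_subset_Icc_self ht))).integral_deriv_eq_sub
      · rw [indicator_of_notMem (fun h : t ∈ dynPts f ∩ Icc a b => hD h.1),
          indicator_of_notMem (fun h : t ∈ dynPts f ∩ Ioo a b => hD h.1)]
    · rw [indicator_of_notMem (fun h : t ∈ dynPts f ∩ Ioo a b => ht h.2)]
      by_cases hD : t ∈ dynPts f ∩ Icc a b
      · rw [indicator_of_mem hD]
        simp [bump, indicator_of_notMem ht]
      · rw [indicator_of_notMem hD]
  have hsplit : ∑' τ, (Ico a b).indicator v τ = v a + ∑' τ, (Ioo a b).indicator v τ := by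
    have h1 : ∀ τ, (Ico a b).indicator v τ
        = ({a} : Set ℝ).indicator v τ + (Ioo a b).indicator v τ := by
      intro τ
      rcases lt_trichotomy τ a with h | rfl | h
      · simp [indicator, h.ne, h.not_ge, h.not_gt]
      · simp [indicator, hab]
      · simp [indicator, h.ne', h.le, h]
    rw [tsum_congr h1, (hv.indicator _).tsum_add (hv.indicator _),
      tsum_eq_single a (fun τ hτ => indicator_of_notMem (by simpa using hτ) _)]
    simp
  rw [derivOn, hst, hsum, hsplit]
  ring

/-! ### The right-hand side on cutoff functions -/

section Pairing

variable {n : ℕ}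

/-- The value on `φ` of the regular distribution `h` plus `∑ l, γ_l v_l`, where `v` is the control
with data `w`, `c`, `τ`, `α`. -/
noncomputable def pairing (w : ℝ → Fin n → ℝ) (c : ℕ → Fin n → ℝ) (τ : ℕ → ℝ)
    (α : ℕ → ℝ → Fin n → ℝ) (h : ℝ → ℝ) (γ : Fin n → DynFun) (φ : DynFun) : ℝ :=
  (∫ t, h t * φ t 0) + ∑ l, ((∫ t, w t l * (γ l t 0 * φ t 0)) +
    ∑' k, c k l * ∫ s in (-1 / 2 : ℝ)..(1 / 2), α k s l * (γ l (τ k) s * φ (τ k) s))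

theorem rhs_eq_pairing (w : ℝ → Fin n → ℝ) (c : ℕ → Fin n → ℝ) (τ : ℕ → ℝ)
    (α : ℕ → ℝ → Fin n → ℝ) (f : ℝ → (Fin n → ℝ) → Fin n → ℝ)
    (g : ℝ → ℝ → (Fin n → ℝ) → Matrix (Fin n) (Fin n) ℝ) (y : ℝ → ℝ → Fin n → ℝ) (j : Fin n)
    (φ : DynFun) :
    rhs f g (control w c τ α) y j φ
      = pairing w c τ α (fun t => f t (y t 0) j) (fun l t s => g t s (y t s) j l) φ := rfl

/-- The contribution of the `l`-th component of the `k`-th impulse to the mass of `φ`. -/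
noncomputable def massTerm (c : ℕ → Fin n → ℝ) (τ : ℕ → ℝ) (α : ℕ → ℝ → Fin n → ℝ) (φ : DynFun)
    (l : Fin n) (k : ℕ) : ℝ :=
  |c k l| * ∫ s in (-1 / 2 : ℝ)..(1 / 2), |α k s l| * φ (τ k) s

/-- The mass of `φ` with respect to Lebesgue measure plus the total variation of the impulses. -/
noncomputable def cutoffMass (c : ℕ → Fin n → ℝ) (τ : ℕ → ℝ) (α : ℕ → ℝ → Fin n → ℝ)
    (φ : DynFun) : ℝ :=
  (∫ t, φ t 0) + ∑ l, ∑' k, massTerm c τ α φ l k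

/-- The total variation of the `l`-th component of the `k`-th impulse. -/
noncomputable def impulseMass (c : ℕ → Fin n → ℝ) (α : ℕ → ℝ → Fin n → ℝ) (l : Fin n) (k : ℕ) :
    ℝ :=
  |c k l| * ∫ s in (-1 / 2 : ℝ)..(1 / 2), |α k s l|

/-- All integrals and series in `pairing` converge. -/
structure Pairable (w : ℝ → Fin n → ℝ) (c : ℕ → Fin n → ℝ) (τ : ℕ → ℝ)
    (α : ℕ → ℝ → Fin n → ℝ) (h : ℝ → ℝ) (γ : Fin n → DynFun) (φ : DynFun) : Prop where
  regular : Integrable (fun t => h t * φ t 0)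
  control : ∀ l, Integrable (fun t => w t l * (γ l t 0 * φ t 0))
  impulse : ∀ l k, IntervalIntegrable (fun s => α k s l * (γ l (τ k) s * φ (τ k) s)) volume
    (-1 / 2) (1 / 2)
  summable : ∀ l, Summable (fun k =>
    c k l * ∫ s in (-1 / 2 : ℝ)..(1 / 2), α k s l * (γ l (τ k) s * φ (τ k) s))

variable {w : ℝ → Fin n → ℝ} {c : ℕ → Fin n → ℝ} {τ : ℕ → ℝ} {α : ℕ → ℝ → Fin n → ℝ}
  {h h' : ℝ → ℝ} {γ γ' : Fin n → DynFun} {φ : DynFun}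

theorem pairing_sub (hp : Pairable w c τ α h γ φ) (hp' : Pairable w c τ α h' γ' φ) :
    pairing w c τ α h γ φ - pairing w c τ α h' γ' φ
      = pairing w c τ α (fun t => h t - h' t) (fun l t s => γ l t s - γ' l t s) φ := by
  unfold pairing
  rw [add_sub_add_comm, ← integral_sub hp.regular hp'.regular, ← Finset.sum_sub_distrib]
  congr 1
  · exact integral_congr_ae (Eventually.of_forall fun t => by ring)
  · refine Finset.sum_congr rfl fun l _ => ?_
    rw [add_sub_add_comm, ← integral_sub (hp.control l) (hp'.control l),
      ← (hp.summable l).tsum_sub (hp'.summable l)]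
    congr 1
    · exact integral_congr_ae (Eventually.of_forall fun t => by ring)
    · refine tsum_congr fun k => ?_
      rw [← mul_sub, ← intervalIntegral.integral_sub (hp.impulse l k) (hp'.impulse l k)]
      congr 1
      exact intervalIntegral.integral_congr fun s _ => by ring

theorem mem_J_of_mem_Ioc {s : ℝ} (hs : s ∈ Ioc (-1 / 2 : ℝ) (1 / 2)) : s ∈ J :=
  Ioc_subset_Icc_self hs

theorem intervalIntegrable_mul_cutoff {β : ℝ → ℝ} (hβ : ContinuousOn β J) (hφ : IsCutoff φ)
    (t : ℝ) : IntervalIntegrable (fun s => β s * φ t s) volume (-1 / 2) (1 / 2) := by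
  have h1 : IntervalIntegrable β volume (-1 / 2) (1 / 2) :=
    hβ.intervalIntegrable_of_Icc (by norm_num)
  rw [intervalIntegrable_iff] at h1 ⊢
  refine h1.mul_bdd (c := 1) (hφ.measurable_value t).aestronglyMeasurable ?_
  refine Eventually.of_forall fun s => ?_
  rw [Real.norm_eq_abs, abs_of_nonneg (hφ.nonneg t s)]
  exact hφ.le_one t s

theorem continuousOn_component {k : ℕ} (hα : ContinuousOn (α k) J) (l : Fin n) :
    ContinuousOn (fun s => α k s l) J :=
  continuousOn_pi.1 hα l

theorem massTerm_nonneg (hφ : IsCutoff φ) (l : Fin n) (k : ℕ) : 0 ≤ massTerm c τ α φ l k :=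
  mul_nonneg (abs_nonneg _) (intervalIntegral.integral_nonneg (by norm_num)
    fun s _ => mul_nonneg (abs_nonneg _) (hφ.nonneg _ _))

theorem cutoffMass_nonneg (hφ : IsCutoff φ) : 0 ≤ cutoffMass c τ α φ :=
  add_nonneg (integral_nonneg fun t => hφ.nonneg t 0)
    (Finset.sum_nonneg fun l _ => tsum_nonneg fun k => massTerm_nonneg hφ l k)

theorem abs_impulse_le (hα : ∀ k, ContinuousOn (α k) J) (hφ : IsCutoff φ) {Γ : ℝ}
    (hΓ : ∀ l t, ∀ s ∈ J, φ t s ≠ 0 → |γ l t s| ≤ Γ) (l : Fin n) (k : ℕ) :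
    |c k l * ∫ s in (-1 / 2 : ℝ)..(1 / 2), α k s l * (γ l (τ k) s * φ (τ k) s)|
      ≤ Γ * massTerm c τ α φ l k := by
  have hc := (continuousOn_component (hα k) l).abs
  have h1 : |∫ s in (-1 / 2 : ℝ)..(1 / 2), α k s l * (γ l (τ k) s * φ (τ k) s)|
      ≤ ∫ s in (-1 / 2 : ℝ)..(1 / 2), Γ * (|α k s l| * φ (τ k) s) := by
    rw [← Real.norm_eq_abs]
    refine intervalIntegral.norm_integral_le_of_norm_le (by norm_num) ?_
      ((intervalIntegrable_mul_cutoff hc hφ _).const_mul Γ)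
    refine Eventually.of_forall fun s hs => ?_
    rw [Real.norm_eq_abs, abs_mul, abs_mul, abs_of_nonneg (hφ.nonneg _ _)]
    by_cases h0 : φ (τ k) s = 0
    · simp [h0]
    · have := hΓ l (τ k) s (mem_J_of_mem_Ioc hs) h0
      calc |α k s l| * (|γ l (τ k) s| * φ (τ k) s)
          ≤ |α k s l| * (Γ * φ (τ k) s) := by
            gcongr
            exact hφ.nonneg _ _
        _ = _ := by ring
  rw [intervalIntegral.integral_const_mul] at h1
  rw [abs_mul, massTerm]
  calc _ ≤ |c k l| * (Γ * ∫ s in (-1 / 2 : ℝ)..(1 / 2), |α k s l| * φ (τ k) s) := by gcongr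
    _ = _ := by ring

theorem Pairable.of_bounds (hα : ∀ k, ContinuousOn (α k) J) (hφ : IsCutoff φ)
    (hreg : Integrable (fun t => h t * φ t 0))
    (hctl : ∀ l, Integrable (fun t => w t l * (γ l t 0 * φ t 0)))
    (hγ : ∀ l t, (∃ s ∈ J, φ t s ≠ 0) → ContinuousOn (γ l t) J)
    (hmass : ∀ l, Summable (massTerm c τ α φ l)) {Γ : ℝ}
    (hΓ : ∀ l t, ∀ s ∈ J, φ t s ≠ 0 → |γ l t s| ≤ Γ) : Pairable w c τ α h γ φ where
  regular := hreg
  control := hctl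
  impulse l k := by
    by_cases hs : ∃ s ∈ J, φ (τ k) s ≠ 0
    · have := intervalIntegrable_mul_cutoff
        ((continuousOn_component (hα k) l).mul (hγ l (τ k) hs)) hφ (τ k)
      simpa only [Pi.mul_apply, mul_assoc] using this
    · push Not at hs
      refine (intervalIntegrable_const (c := (0 : ℝ))).congr fun s hs' => ?_
      rw [uIoc_of_le (by norm_num)] at hs'
      simp [hs s (mem_J_of_mem_Ioc hs')]
  summable l := by
    refine Summable.of_norm_bounded ((hmass l).mul_left Γ) fun k => ?_
    rw [Real.norm_eq_abs]
    exact abs_impulse_le hα hφ hΓ l k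

/-- The regular part and `w` are integrated against the Lebesgue part of the mass, the impulses
against the remaining part. Both parts are nonnegative, so each may be enlarged to the whole mass.
-/
theorem abs_pairing_le (hα : ∀ k, ContinuousOn (α k) J) (hφ : IsCutoff φ)
    (hint : Integrable (fun t => φ t 0)) (hmass : ∀ l, Summable (massTerm c τ α φ l))
    {H Γ W : ℝ} (hH0 : 0 ≤ H) (hΓ0 : 0 ≤ Γ) (hW0 : 0 ≤ W)
    (hH : ∀ t, φ t 0 ≠ 0 → |h t| ≤ H) (hW : ∀ l t, φ t 0 ≠ 0 → |w t l| ≤ W)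
    (hΓ : ∀ l t, ∀ s ∈ J, φ t s ≠ 0 → |γ l t s| ≤ Γ) :
    |pairing w c τ α h γ φ| ≤ (H + Γ + n * (W * Γ)) * cutoffMass c τ α φ := by
  have h1 : |∫ t, h t * φ t 0| ≤ H * ∫ t, φ t 0 := by
    rw [← Real.norm_eq_abs, ← integral_const_mul]
    refine norm_integral_le_of_norm_le (hint.const_mul H) (Eventually.of_forall fun t => ?_)
    rw [norm_mul, Real.norm_eq_abs, Real.norm_eq_abs, abs_of_nonneg (hφ.nonneg _ _)]
    by_cases h0 : φ t 0 = 0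
    · simp [h0]
    · exact mul_le_mul_of_nonneg_right (hH t h0) (hφ.nonneg _ _)
  have h2 : ∀ l, |∫ t, w t l * (γ l t 0 * φ t 0)| ≤ W * Γ * ∫ t, φ t 0 := by
    intro l
    rw [← Real.norm_eq_abs, ← integral_const_mul]
    refine norm_integral_le_of_norm_le (hint.const_mul _) (Eventually.of_forall fun t => ?_)
    rw [norm_mul, norm_mul, Real.norm_eq_abs, Real.norm_eq_abs, Real.norm_eq_abs,
      abs_of_nonneg (hφ.nonneg _ _), ← mul_assoc]
    by_cases h0 : φ t 0 = 0
    · simp [h0]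
    · refine mul_le_mul_of_nonneg_right ?_ (hφ.nonneg _ _)
      exact mul_le_mul (hW l t h0) (hΓ l t 0 zero_mem_J h0) (abs_nonneg _) hW0
  have h3 : ∀ l, |∑' k, c k l * ∫ s in (-1 / 2 : ℝ)..(1 / 2), α k s l * (γ l (τ k) s * φ (τ k) s)|
      ≤ Γ * ∑' k, massTerm c τ α φ l k := by
    intro l
    rw [← Real.norm_eq_abs]
    refine tsum_of_norm_bounded ((hmass l).hasSum.mul_left Γ) fun k => ?_
    rw [Real.norm_eq_abs]
    exact abs_impulse_le hα hφ hΓ l k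
  have hI0 : 0 ≤ ∫ t, φ t 0 := integral_nonneg fun t => hφ.nonneg t 0
  have hS0 : 0 ≤ ∑ l, ∑' k, massTerm c τ α φ l k :=
    Finset.sum_nonneg fun l _ => tsum_nonneg fun k => massTerm_nonneg hφ l k
  calc |pairing w c τ α h γ φ|
      ≤ H * (∫ t, φ t 0) + ∑ l, (W * Γ * (∫ t, φ t 0) + Γ * ∑' k, massTerm c τ α φ l k) := by
        refine (abs_add_le _ _).trans (add_le_add h1 ?_)
        refine (Finset.abs_sum_le_sum_abs _ _).trans (Finset.sum_le_sum fun l _ => ?_)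
        exact (abs_add_le _ _).trans (add_le_add (h2 l) (h3 l))
    _ = (H + n * (W * Γ)) * (∫ t, φ t 0) + Γ * ∑ l, ∑' k, massTerm c τ α φ l k := by
        simp only [Finset.sum_add_distrib, Finset.sum_const, Finset.card_univ, Fintype.card_fin,
          nsmul_eq_mul, Finset.mul_sum]
        ring
    _ ≤ _ := by
        unfold cutoffMass
        have : 0 ≤ n * (W * Γ) := by positivity
        nlinarith [mul_nonneg hH0 hS0, mul_nonneg this hS0, mul_nonneg hΓ0 hI0]

/-! ### Masses of elementary test functions -/

theorem massTerm_bump (a b : ℝ) (l : Fin n) (k : ℕ) :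
    massTerm c τ α (bump a b) l k
      = (Ioo a b).indicator (fun _ => impulseMass c α l k) (τ k) := by
  by_cases hk : τ k ∈ Ioo a b <;> simp [massTerm, bump, impulseMass, hk]

theorem massTerm_spike_of_ne {t : ℝ} {k : ℕ} (hk : τ k ≠ t) (a b : ℝ) (l : Fin n) :
    massTerm c τ α (spike t a b) l k = 0 := by
  simp [massTerm, spike_of_ne hk]

theorem massTerm_spike_self {a b : ℝ} (ha : -1 / 2 ≤ a) (hab : a ≤ b) (hb : b ≤ 1 / 2)
    (l : Fin n) (k : ℕ) :
    massTerm c τ α (spike (τ k) a b) l k = |c k l| * ∫ s in a..b, |α k s l| := by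
  simp only [massTerm, spike_self]
  rw [integral_mul_indicator_Ioc ha hab hb]

theorem integrable_ord_bump (a b : ℝ) : Integrable (fun t => bump a b t 0) :=
  (integrable_indicator_iff measurableSet_Ioo).2 (by simp)

theorem integral_ord_bump {a b : ℝ} (hab : a ≤ b) : ∫ t, bump a b t 0 = b - a := by
  simp only [bump]
  rw [integral_indicator_const _ measurableSet_Ioo]
  simp [hab]

theorem ord_spike_ae_eq (t a b : ℝ) : (fun r => spike t a b r 0) =ᵐ[volume] 0 := by
  filter_upwards [Measure.ae_ne volume t] with r hr
  simp [spike_of_ne hr]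

theorem integrable_mul_ord_spike (q : ℝ → ℝ) (t a b : ℝ) :
    Integrable (fun r => q r * spike t a b r 0) := by
  refine (integrable_zero ℝ ℝ volume).congr ?_
  filter_upwards [ord_spike_ae_eq t a b] with r hr
  simp [hr]

theorem summable_massTerm_spike (hτi : Function.Injective τ) (t a b : ℝ) (l : Fin n) :
    Summable (massTerm c τ α (spike t a b) l) := by
  by_cases h : ∃ k, τ k = t
  · obtain ⟨k, rfl⟩ := h
    exact summable_of_ne_finset_zero (s := {k}) fun k' hk' =>
      massTerm_spike_of_ne (fun h => hk' (by simp [hτi h])) _ _ _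
  · push Not at h
    exact summable_zero.congr fun k => (massTerm_spike_of_ne (h k) _ _ _).symm

theorem cutoffMass_spike (hτi : Function.Injective τ) {a b : ℝ} (ha : -1 / 2 ≤ a) (hab : a ≤ b)
    (hb : b ≤ 1 / 2) (k : ℕ) :
    cutoffMass c τ α (spike (τ k) a b) = ∑ l, |c k l| * ∫ s in a..b, |α k s l| := by
  unfold cutoffMass
  rw [integral_congr_ae (ord_spike_ae_eq _ _ _)]
  simp only [Pi.zero_apply, integral_zero, zero_add]
  refine Finset.sum_congr rfl fun l _ => ?_
  rw [tsum_eq_single k, massTerm_spike_self ha hab hb]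
  intro k' hk'
  exact massTerm_spike_of_ne (fun h => hk' (hτi h)) _ _ _

/-- A spike is null for Lebesgue measure, and injectivity of `τ` leaves a single impulse at its
point. -/
theorem pairing_spike (hτi : Function.Injective τ) (k : ℕ) (a b : ℝ) :
    pairing w c τ α h γ (spike (τ k) a b) = ∑ l, c k l * ∫ s in (-1 / 2 : ℝ)..(1 / 2),
      α k s l * (γ l (τ k) s * spike (τ k) a b (τ k) s) := by
  unfold pairing
  have h1 : ∀ q : ℝ → ℝ, ∫ r, q r * spike (τ k) a b r 0 = 0 := fun q => by
    exact integral_mul_ord_spike q _ _ _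
  rw [h1, zero_add]
  refine Finset.sum_congr rfl fun l _ => ?_
  have h2 := h1 (fun r => w r l * γ l r 0)
  simp only [mul_assoc] at h2
  rw [h2, zero_add, tsum_eq_single k]
  intro k' hk'
  simp [spike_of_ne (fun h => hk' (hτi h) : τ k' ≠ τ k)]

theorem pairing_spike_of_notMem_range {t : ℝ} (ht : ∀ k, τ k ≠ t) (a b : ℝ) :
    pairing w c τ α h γ (spike t a b) = 0 := by
  unfold pairing
  have h1 : ∀ q : ℝ → ℝ, ∫ r, q r * spike t a b r 0 = 0 := fun q => by
    exact integral_mul_ord_spike q _ _ _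
  rw [h1, zero_add]
  refine Finset.sum_eq_zero fun l _ => ?_
  have h2 := h1 (fun r => w r l * γ l r 0)
  simp only [mul_assoc] at h2
  rw [h2, zero_add]
  simp [spike_of_ne (ht _)]

theorem control_spike (hτi : Function.Injective τ) (k : ℕ) {a b : ℝ} (ha : -1 / 2 ≤ a)
    (hab : a ≤ b) (hb : b ≤ 1 / 2) (l : Fin n) :
    control w c τ α l (spike (τ k) a b) = c k l * ∫ s in a..b, α k s l := by
  simp only [control, regular, impulse, delta, ord]
  rw [integral_mul_ord_spike, zero_add, tsum_eq_single k]
  · simp only [spike_self]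
    rw [integral_mul_indicator_Ioc ha hab hb]
  · intro k' hk'
    simp [spike_of_ne (fun h => hk' (hτi h) : τ k' ≠ τ k)]

theorem impulseMass_nonneg (l : Fin n) (k : ℕ) : 0 ≤ impulseMass c α l k :=
  mul_nonneg (abs_nonneg _) (intervalIntegral.integral_nonneg (by norm_num)
    fun _ _ => abs_nonneg _)

/-- If the control is the derivative of a function of locally bounded variation, then the masses
of its impulses are locally summable. -/
theorem summable_impulseMass {I : Set ℝ} (hτi : Function.Injective τ)
    (hα : ∀ k, ContinuousOn (α k) J) {l : Fin n} {u : DynFun} (hu : IsSBVLoc I u)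
    (hder : DerivEq I u (control w c τ α l)) {p q : ℝ} (hpq : Icc p q ⊆ I) :
    Summable (fun k => (Icc p q).indicator (fun _ => impulseMass c α l k) (τ k)) := by
  -- Testing the equation for the primitive on spikes identifies the inner profile of its jump at `τ
  -- k` as the primitive of the impulse. Its variation therefore dominates `impulseMass`.
  have hinc : ∀ k, τ k ∈ I → ∀ a b, -1 / 2 ≤ a → a ≤ b → b ≤ 1 / 2 →
      u (τ k) b - u (τ k) a = ∫ s in a..b, c k l * α k s l := by
    intro k hk a b ha hab hb
    rw [← derivOn_spike hu.isSG hk ha hab hb,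
      hder (τ k) (τ k) le_rfl (by simpa using hk) _ (isTestOn_spike _ _ _),
      control_spike hτi k ha hab hb, intervalIntegral.integral_const_mul]
  have hvar : ∀ k, τ k ∈ I → ENNReal.ofReal (impulseMass c α l k) ≤ eVariationOn (u (τ k)) J := by
    intro k hk
    have := integral_abs_le_eVariationOn (u := u (τ k)) (β := fun s => c k l * α k s l)
      (a := -1 / 2) (b := 1 / 2) (by norm_num)
      (continuousOn_const.mul (continuousOn_component (hα k) l))
      (fun s hs => hinc k hk _ _ le_rfl hs.1 hs.2)
    simp only [abs_mul] at this
    rwa [intervalIntegral.integral_const_mul] at this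
  set V : ℝ → ENNReal := (dynPts u ∩ Icc p q).indicator (fun t => eVariationOn (u t) J) with hV
  have hVfin : ∑' t, V t ≠ ⊤ := by
    have := hu.dynBV p q hpq
    rwa [tsum_subtype (dynPts u ∩ Icc p q) (fun t => eVariationOn (u t) J)] at this
  have hle : ∀ k, ENNReal.ofReal ((Icc p q).indicator (fun _ => impulseMass c α l k) (τ k))
      ≤ V (τ k) := by
    intro k
    by_cases hk : τ k ∈ Icc p q
    · rw [indicator_of_mem hk]
      by_cases hD : τ k ∈ dynPts u
      · rw [hV, indicator_of_mem (mem_inter hD hk)]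
        exact hvar k (hpq hk)
      -- An ordinary value has zero variation, so the impulse at such a point has zero mass.
      · refine (hvar k (hpq hk)).trans ?_
        rw [eVariationOn.constant_on]
        · exact zero_le
        · rintro _ ⟨s, hs, rfl⟩ _ ⟨s', hs', rfl⟩
          exact eq_of_notMem_dynPts hD hs hs'
    · rw [indicator_of_notMem hk]; simp
  have hfin : ∑' k, ENNReal.ofReal ((Icc p q).indicator (fun _ => impulseMass c α l k) (τ k))
      ≠ ⊤ := by
    refine ne_top_of_le_ne_top hVfin ((ENNReal.tsum_le_tsum hle).trans ?_)
    -- Distinct indices are charged to distinct points, hence the sum over `k` is bounded by the sum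
    -- over points.
    exact ENNReal.tsum_comp_le_tsum_of_injective hτi V
  refine (ENNReal.summable_toReal hfin).congr fun k => ?_
  rw [ENNReal.toReal_ofReal]
  exact indicator_nonneg (fun _ _ => impulseMass_nonneg l k) _

end Pairing

/-! ### Regularity of the coefficients along trajectories -/

section Coefficients

variable {n m : ℕ}

/-- The regularity of the right-hand side and of the control used in the proof of viability. -/
structure CoeffReg (I : Set ℝ) (N : Set (Fin n → ℝ)) (f : ℝ → (Fin n → ℝ) → Fin n → ℝ) (Kf : ℝ)
    (g : ℝ → ℝ → (Fin n → ℝ) → Matrix (Fin n) (Fin n) ℝ) (Kg : ℝ) (w : ℝ → Fin n → ℝ)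
    (c : ℕ → Fin n → ℝ) (τ : ℕ → ℝ) (α : ℕ → ℝ → Fin n → ℝ) : Prop where
  isOpen : IsOpen I
  lipF : ∀ t ∈ I, ∀ x ∈ N, ∀ y ∈ N, ‖f t x - f t y‖ ≤ Kf * ‖x - y‖
  isSG : ∀ x ∈ N, ∀ j l, IsSG I (fun t s => g t s x j l)
  lipG : ∀ t ∈ I, ∀ s ∈ J, ∀ x ∈ N, ∀ y ∈ N, ∀ j l,
    |g t s x j l - g t s y j l| ≤ Kg * ‖x - y‖
  continuousOn_w : ContinuousOn w I
  injective : Function.Injective τ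
  continuousOn_shape : ∀ k, ContinuousOn (α k) J
  summable : ∀ p q, Icc p q ⊆ I → ∀ l,
    Summable (fun k => (Icc p q).indicator (fun _ => impulseMass c α l k) (τ k))

variable {I : Set ℝ} {N : Set (Fin n → ℝ)} {f : ℝ → (Fin n → ℝ) → Fin n → ℝ} {Kf Kg : ℝ}
  {g : ℝ → ℝ → (Fin n → ℝ) → Matrix (Fin n) (Fin n) ℝ} {w : ℝ → Fin n → ℝ}
  {c : ℕ → Fin n → ℝ} {τ : ℕ → ℝ} {α : ℕ → ℝ → Fin n → ℝ}

theorem CoeffReg.continuousOn_value (h : CoeffReg I N f Kf g Kg w c τ α) {t : ℝ} (ht : t ∈ I)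
    {ξ : ℝ → Fin n → ℝ} (hξ : ContinuousOn ξ J) (hξN : ∀ s ∈ J, ξ s ∈ N) (j l : Fin n) :
    ContinuousOn (fun s => g t s (ξ s) j l) J := by
  intro s hs
  refine tendsto_comp_of_lipschitz (h := fun r z => g t r z j l) (K := Kg)
    ((h.isSG (ξ s) (hξN s hs) j l).continuousOn ht s hs) (hξ s hs) ?_
  filter_upwards [self_mem_nhdsWithin] with r hr
  exact h.lipG t ht r hr _ (hξN r hr) _ (hξN s hs) j l

theorem exists_bound_on_J {ι : Type*} [Fintype ι] {γ : ι → ℝ → ℝ}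
    (hγ : ∀ l, ContinuousOn (γ l) J) : ∃ Γ, 0 ≤ Γ ∧ ∀ l, ∀ s ∈ J, |γ l s| ≤ Γ := by
  have h : ∀ l, ∃ C, ∀ s ∈ J, ‖γ l s‖ ≤ C := fun l =>
    isCompact_Icc.exists_bound_of_continuousOn (hγ l)
  choose C hC using h
  refine ⟨∑ l, |C l|, Finset.sum_nonneg fun _ _ => abs_nonneg _, fun l s hs => ?_⟩
  calc |γ l s| ≤ C l := hC l s hs
    _ ≤ |C l| := le_abs_self _
    _ ≤ _ := Finset.single_le_sum (f := fun l => |C l|) (fun _ _ => abs_nonneg _)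
      (Finset.mem_univ l)

theorem pairable_spike (hα : ∀ k, ContinuousOn (α k) J) (hτi : Function.Injective τ)
    {h : ℝ → ℝ} {γ : Fin n → DynFun} {t : ℝ} (hγ : ∀ l, ContinuousOn (γ l t) J) (a b : ℝ) :
    Pairable w c τ α h γ (spike t a b) := by
  have hsupp : ∀ r s, spike t a b r s ≠ 0 → r = t := by
    intro r s hrs
    by_contra hne
    exact hrs (spike_of_ne hne _ _ _)
  obtain ⟨Γ, -, hΓ⟩ := exists_bound_on_J hγ
  refine Pairable.of_bounds (Γ := Γ) hα (isCutoff_spike t a b) (integrable_mul_ord_spike _ _ _ _)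
    (fun l => ?_) ?_ (summable_massTerm_spike hτi t a b) ?_
  · simpa only [mul_assoc] using
      integrable_mul_ord_spike (fun r => w r l * γ l r 0) t a b
  · rintro l r ⟨s, -, hs⟩
    rw [hsupp r s hs]; exact hγ l
  · intro l r s hsJ hs
    rw [hsupp r s hs]; exact hΓ l s hsJ

/-- The constant that bounds the Lipschitz constant of the right-hand side with respect to the
mass of test functions. -/
noncomputable def lipConst (n : ℕ) (Kf Kg W : ℝ) : ℝ := |Kf| + |Kg| + n * (W * |Kg|)

theorem lipConst_nonneg {W : ℝ} (hW : 0 ≤ W) : 0 ≤ lipConst n Kf Kg W := by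
  unfold lipConst; positivity

/-- This is the cost of freezing the state at `z`: the Lipschitz conditions bound the differences of
the coefficients by multiples of `R`, and `abs_pairing_le` integrates these bounds. -/
theorem CoeffReg.abs_rhs_sub_le (h : CoeffReg I N f Kf g Kg w c τ α) {φ : DynFun}
    (hφ : IsCutoff φ) (hint : Integrable (fun t => φ t 0))
    (hmass : ∀ l, Summable (massTerm c τ α φ l)) {x : ℝ → ℝ → Fin n → ℝ} {z : Fin n → ℝ}
    (hz : z ∈ N) {R W : ℝ} (hR0 : 0 ≤ R) (hW0 : 0 ≤ W)
    (hR : ∀ t, ∀ s ∈ J, φ t s ≠ 0 → t ∈ I ∧ x t s ∈ N ∧ ‖x t s - z‖ ≤ R)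
    (hW : ∀ l t, φ t 0 ≠ 0 → |w t l| ≤ W) {j : Fin n}
    (hp : Pairable w c τ α (fun t => f t (x t 0) j) (fun l t s => g t s (x t s) j l) φ)
    (hp' : Pairable w c τ α (fun t => f t z j) (fun l t s => g t s z j l) φ) :
    |rhs f g (control w c τ α) x j φ - rhs f g (control w c τ α) (fun _ _ => z) j φ|
      ≤ lipConst n Kf Kg W * R * cutoffMass c τ α φ := by
  rw [rhs_eq_pairing, rhs_eq_pairing, pairing_sub hp hp']
  have key := abs_pairing_le (w := w) (h := fun t => f t (x t 0) j - f t z j)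
    (γ := fun l t s => g t s (x t s) j l - g t s z j l) h.continuousOn_shape hφ hint hmass
    (H := |Kf| * R) (Γ := |Kg| * R) (W := W) (by positivity) (by positivity) hW0
    (fun t ht => ?_) hW (fun l t s hs ht => ?_)
  · refine key.trans (le_of_eq ?_)
    unfold lipConst; ring
  · obtain ⟨h1, h2, h3⟩ := hR t 0 zero_mem_J ht
    calc |f t (x t 0) j - f t z j| ≤ ‖f t (x t 0) - f t z‖ :=
          norm_le_pi_norm (f t (x t 0) - f t z) j
      _ ≤ Kf * ‖x t 0 - z‖ := h.lipF t h1 _ h2 _ hz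
      _ ≤ |Kf| * R := mul_le_mul (le_abs_self _) h3 (norm_nonneg _) (abs_nonneg _)
  · obtain ⟨h1, h2, h3⟩ := hR t s hs ht
    calc |g t s (x t s) j l - g t s z j l| ≤ Kg * ‖x t s - z‖ := h.lipG t h1 s hs _ h2 _ hz j l
      _ ≤ |Kg| * R := mul_le_mul (le_abs_self _) h3 (norm_nonneg _) (abs_nonneg _)

/-! ### Jumps -/

/-- The constraint set `M = {η_i ≤ 0}` with its regularity. -/
structure ConstraintReg (η : Fin m → (Fin n → ℝ) → ℝ) (M : Set (Fin n → ℝ)) : Prop where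
  contDiff : ∀ i, ContDiff ℝ 1 (η i)
  eq : M = {x | ∀ i, η i x ≤ 0}
  independent : ∀ x ∈ frontier M,
    LinearIndependent ℝ (fun i : {i // η i x = 0} => grad (η i) x)
  nonempty : M.Nonempty

theorem ConstraintReg.isClosed {η : Fin m → (Fin n → ℝ) → ℝ} {M : Set (Fin n → ℝ)}
    (h : ConstraintReg η M) : IsClosed M := by
  rw [h.eq, ofPred_forall]
  exact isClosed_iInter fun i => isClosed_le (h.contDiff i).continuous continuous_const

/-- The growth rate of the squared distance with respect to the mass. -/
noncomputable def growthRate (n : ℕ) (Kf Kg W : ℝ) : ℝ := n * (4 * lipConst n Kf Kg W + 1)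

theorem growthRate_nonneg {W : ℝ} (hW : 0 ≤ W) : 0 ≤ growthRate n Kf Kg W := by
  have := lipConst_nonneg (n := n) (Kf := Kf) (Kg := Kg) hW
  unfold growthRate; positivity

/-- The distance of a trajectory to `M` grows at most exponentially with the mass of a jump. -/
theorem CoeffReg.sqDist_jump_le (h : CoeffReg I N f Kf g Kg w c τ α)
    {η : Fin m → (Fin n → ℝ) → ℝ} {M : Set (Fin n → ℝ)} (hM : ConstraintReg η M) (hMN : M ⊆ N)
    {x : ℝ → ℝ → Fin n → ℝ} {t : ℝ} (ht : t ∈ I) (hxc : ContinuousOn (x t) J)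
    (hxN : ∀ s ∈ J, x t s ∈ N)
    (hinc : ∀ a b, -1 / 2 ≤ a → a ≤ b → b ≤ 1 / 2 → ∀ j,
      x t b j - x t a j = rhs f g (control w c τ α) x j (spike t a b))
    (hfeas : ∀ k, τ k = t → ∀ y ∈ frontier M, ∀ i, η i y = 0 → ∀ a b,
      grad (η i) y ⬝ᵥ (fun j => rhs f g (control w c τ α) (fun _ _ => y) j (spike t a b)) ≤ 0)
    {W : ℝ} (hW0 : 0 ≤ W) (hW : ∀ l, |w t l| ≤ W) {β₀ : ℝ} (hβ₀ : 0 < β₀)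
    (hinit : sqDist M (x t (-1 / 2)) ≤ β₀) :
    ∀ s ∈ J, sqDist M (x t s) ≤
      β₀ * Real.exp (growthRate n Kf Kg W * cutoffMass c τ α (spike t (-1 / 2) (1 / 2))) := by
  set C := growthRate n Kf Kg W with hC
  have hC0 : 0 ≤ C := growthRate_nonneg hW0
  by_cases hk : ∃ k, τ k = t
  swap
  · push Not at hk
    -- Without an impulse at `t`, every spike there pairs to zero, so the dynamic value is constant.
    intro s hs
    have : x t s = x t (-1 / 2) := by
      ext j
      have := hinc (-1 / 2) s le_rfl hs.1 hs.2 j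
      rw [rhs_eq_pairing, pairing_spike_of_notMem_range hk] at this
      linarith
    rw [this]
    refine hinit.trans (le_mul_of_one_le_right hβ₀.le (Real.one_le_exp ?_))
    exact mul_nonneg hC0 (cutoffMass_nonneg (isCutoff_spike _ _ _))
  obtain ⟨k, rfl⟩ := hk
  have hαc : ∀ l, ContinuousOn (fun s => |α k s l|) J :=
    fun l => (continuousOn_component (h.continuousOn_shape k) l).abs
  -- `A s` is the impulse mass spent during the inner time from `-1/2` to `s`; it plays the role of
  -- a clock for the jump.
  set A : ℝ → ℝ := fun s => ∑ l, |c k l| * ∫ r in (-1 / 2 : ℝ)..s, |α k r l| with hA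
  have hαi : ∀ l, ∀ a ∈ J, ∀ b ∈ J, IntervalIntegrable (fun s => |α k s l|) volume a b := by
    intro l a ha b hb
    exact ((hαc l).mono (ordConnected_Icc.uIcc_subset ha hb)).intervalIntegrable
  have hAmass : ∀ s ∈ J, A s = cutoffMass c τ α (spike (τ k) (-1 / 2) s) := fun s hs => by
    rw [cutoffMass_spike h.injective le_rfl hs.1 hs.2]
  have hAdiff : ∀ a b, -1 / 2 ≤ a → a ≤ b → b ≤ 1 / 2 →
      A b = A a + cutoffMass c τ α (spike (τ k) a b) := by
    intro a b ha hab hb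
    rw [cutoffMass_spike h.injective ha hab hb, hA]
    simp only
    rw [← Finset.sum_add_distrib]
    refine Finset.sum_congr rfl fun l _ => ?_
    rw [← mul_add, intervalIntegral.integral_add_adjacent_intervals]
    · exact hαi l _ left_mem_J _ ⟨ha, hab.trans hb⟩
    · exact hαi l _ ⟨ha, hab.trans hb⟩ _ ⟨ha.trans hab, hb⟩
  have hAmono : MonotoneOn A J := by
    intro a ha b hb hab
    rw [hAdiff a b ha.1 hab hb.2]
    linarith [cutoffMass_nonneg (c := c) (τ := τ) (α := α) (isCutoff_spike (τ k) a b)]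
  have hAcont : ContinuousOn A J := by
    refine continuousOn_finsetSum _ fun l _ => continuousOn_const.mul ?_
    have h1 : IntegrableOn (fun s => |α k s l|) (uIcc (-1 / 2) (1 / 2)) := by
      rw [uIcc_of_le (by norm_num)]
      exact (hαc l).integrableOn_Icc
    have h2 := intervalIntegral.continuousOn_primitive_interval h1
    rwa [uIcc_of_le (by norm_num)] at h2
  have hmain : ∀ s ∈ Icc (-1 / 2 : ℝ) (1 / 2), sqDist M (x (τ k) s) ≤ β₀ * Real.exp (C * A s) := by
    refine le_of_forall_eventually_le (fun a ha b hb hab => ?_) (fun s hs => ?_) ?_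
      (fun s hs hle => ?_)
    · have := hAmono ha hb hab
      gcongr
    · have : Tendsto (x (τ k)) (𝓝[<] s) (𝓝 (x (τ k) s)) :=
        (hxc s (Ioc_subset_Icc_self hs)).mono_left
          (nhdsWithin_le_iff.2 (Icc_mem_nhdsLT_of_mem hs))
      exact ((continuous_sqDist M).tendsto _).comp this
    · simpa [hA] using hinit
    have hsJ : s ∈ J := Ico_subset_Icc_self hs
    have hnhds : 𝓝[>] s ≤ 𝓝[J] s := nhdsWithin_le_iff.2 (Icc_mem_nhdsGT_of_mem hs)
    have hxs : Tendsto (x (τ k)) (𝓝[>] s) (𝓝 (x (τ k) s)) := (hxc s hsJ).mono_left hnhds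
    have hAs : Tendsto A (𝓝[>] s) (𝓝 (A s)) := (hAcont s hsJ).mono_left hnhds
    -- On `M` there is no outward normal to work with, but continuity keeps the squared distance
    -- below `β₀ > 0`, hence below the barrier.
    rcases (sqDist_nonneg M (x (τ k) s)).eq_or_lt with h0 | hpos
    · have := (((continuous_sqDist M).tendsto _).comp hxs).eventually_lt_const
        (u := β₀) (by rw [← h0]; exact hβ₀)
      filter_upwards [this, self_mem_nhdsWithin] with s' hs' hss hs'b
      have hA0 : 0 ≤ A s' := by
        rw [hAmass s' ⟨hs.1.trans (le_of_lt hss), hs'b.le⟩]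
        exact cutoffMass_nonneg (isCutoff_spike _ _ _)
      exact hs'.le.trans (le_mul_of_one_le_right hβ₀.le (Real.one_le_exp (mul_nonneg hC0 hA0)))
    · obtain ⟨y, hyf, R, hR0, hyR, hstep⟩ := exists_sqDist_add_le hM.contDiff hM.eq hM.isClosed
        hM.nonempty hM.independent (lipConst_nonneg (n := n) (Kf := Kf) (Kg := Kg) hW0) hpos
      have hyN : y ∈ N := hMN (hM.isClosed.frontier_subset hyf)
      have hgy : ∀ j l, ContinuousOn (fun s => g (τ k) s y j l) J := fun j l =>
        h.continuousOn_value ht continuousOn_const (fun _ _ => hyN) j l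
      obtain ⟨Γ, hΓ0, hΓ⟩ := exists_bound_on_J (γ := fun (p : Fin n × Fin n) s =>
        g (τ k) s y p.1 p.2) (fun p => hgy p.1 p.2)
      -- The constant that `abs_pairing_le` gives for the frozen right-hand side. The term with `f`
      -- contributes nothing on spikes and only matches the form of that bound.
      obtain ⟨δ, hδ, hstep⟩ := hstep (‖f (τ k) y‖ + Γ + n * (W * Γ)) (by positivity)
      have hev1 : ∀ᶠ s' in 𝓝[>] s, ‖x (τ k) s' - y‖ < R :=
        ((hxs.sub_const y).norm).eventually_lt_const hyR
      obtain ⟨u, hu, husub⟩ := mem_nhdsGT_iff_exists_Ioo_subset.1 hev1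
      have hev2 : ∀ᶠ s' in 𝓝[>] s, A s' < A s + δ := hAs.eventually_lt_const (by linarith)
      filter_upwards [hev2, Ioo_mem_nhdsGT hu] with s' hAs' hs'u hs'b
      have hss : s ≤ s' := hs'u.1.le
      have hs'J : s' ∈ J := ⟨hs.1.trans hss, hs'b.le⟩
      set φ := spike (τ k) s s' with hφ
      have hρ := hAdiff s s' hs.1 hss hs'b.le
      have hsupp : ∀ r q, φ r q ≠ 0 → r = τ k ∧ q ∈ Ioc s s' := by
        intro r q hrq
        have hr : r = τ k := by
          by_contra hne
          exact hrq (spike_of_ne hne _ _ _)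
        refine ⟨hr, ?_⟩
        by_contra hne
        rw [hr, hφ, spike_self, indicator_of_notMem hne] at hrq
        exact hrq rfl
      have hp : ∀ j, Pairable w c τ α (fun t => f t (x t 0) j)
          (fun l t s => g t s (x t s) j l) φ := fun j =>
        pairable_spike h.continuousOn_shape h.injective
          (fun l => h.continuousOn_value ht hxc hxN j l) _ _
      have hp' : ∀ j, Pairable w c τ α (fun t => f t y j) (fun l t s => g t s y j l) φ :=
        fun j => pairable_spike h.continuousOn_shape h.injective (fun l => hgy j l) _ _
      have hint : Integrable (fun r => φ r 0) := by
        simpa using integrable_mul_ord_spike (fun _ => 1) (τ k) s s'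
      have hmass := fun l => summable_massTerm_spike (c := c) (α := α) h.injective (τ k) s s' l
      have hRφ : ∀ r, ∀ q ∈ J, φ r q ≠ 0 → r ∈ I ∧ x r q ∈ N ∧ ‖x r q - y‖ ≤ R := by
        intro r q hq hrq
        obtain ⟨rfl, hqs⟩ := hsupp r q hrq
        exact ⟨ht, hxN q hq, le_of_lt (husub ⟨hqs.1, hqs.2.trans_lt hs'u.2⟩)⟩
      have hWφ : ∀ l r, φ r 0 ≠ 0 → |w r l| ≤ W := by
        intro l r hr
        rw [(hsupp r 0 hr).1]; exact hW l
      have hres := hstep (cutoffMass c τ α φ) (cutoffMass_nonneg (isCutoff_spike _ _ _))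
        (by linarith) (fun j => x (τ k) s' j - x (τ k) s j)
        (fun j => rhs f g (control w c τ α) (fun _ _ => y) j φ)
        (fun j => by
          rw [hinc s s' hs.1 hss hs'b.le j]
          exact h.abs_rhs_sub_le (isCutoff_spike _ _ _) hint hmass hyN hR0.le hW0 hRφ hWφ
            (hp j) (hp' j))
        (fun j => by
          rw [rhs_eq_pairing]
          refine abs_pairing_le h.continuousOn_shape (isCutoff_spike _ _ _) hint hmass
            (norm_nonneg _) hΓ0 hW0 (fun r hr => ?_) hWφ (fun l r q hq hrq => ?_)
          · rw [(hsupp r 0 hr).1]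
            exact norm_le_pi_norm (f (τ k) y) j
          · rw [(hsupp r q hrq).1]
            exact hΓ (j, l) q hq)
        (fun i hi => hfeas k rfl y hyf i hi s s')
      have hX : x (τ k) s + (fun j => x (τ k) s' j - x (τ k) s j) = x (τ k) s' := by
        ext j; simp
      rw [hX] at hres
      calc sqDist M (x (τ k) s') ≤ sqDist M (x (τ k) s) * Real.exp (C * cutoffMass c τ α φ) := hres
        _ ≤ β₀ * Real.exp (C * A s) * Real.exp (C * cutoffMass c τ α φ) := by gcongr
        _ = β₀ * Real.exp (C * A s') := by
          rw [hρ, mul_add, Real.exp_add]; ring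
  intro s hs
  refine (hmain s hs).trans ?_
  rw [← hAmass _ right_mem_J]
  have := hAmono hs right_mem_J hs.2
  gcongr

end Coefficients

/-! ### Solutions -/

section Solutions

variable {n m : ℕ} {I : Set ℝ} {N : Set (Fin n → ℝ)} {f : ℝ → (Fin n → ℝ) → Fin n → ℝ}
  {Kf Kg : ℝ} {g : ℝ → ℝ → (Fin n → ℝ) → Matrix (Fin n) (Fin n) ℝ} {w : ℝ → Fin n → ℝ}
  {c : ℕ → Fin n → ℝ} {τ : ℕ → ℝ} {α : ℕ → ℝ → Fin n → ℝ} {v : Fin n → DynFunctional}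
  {t₀ : ℝ} {x₀ : Fin n → ℝ} {S : Set ℝ} {x : ℝ → ℝ → Fin n → ℝ}

theorem IsSolution.continuousOn_value (hx : IsSolution N f g v t₀ x₀ S x) {t : ℝ} (ht : t ∈ S) :
    ContinuousOn (x t) J :=
  continuousOn_pi.2 fun j => (hx.isSBVLoc j).isSG.continuousOn ht

theorem IsSolution.tendsto_left (hx : IsSolution N f g v t₀ x₀ S x) {t : ℝ} (ht : t ∈ S) :
    Tendsto (fun r => x r (-1 / 2)) (𝓝[<] t) (𝓝 (x t (-1 / 2))) :=
  tendsto_pi_nhds.2 fun j => ((hx.isSBVLoc j).isSG.left t ht).tendsto_value left_mem_J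

theorem IsSolution.tendsto_right (hx : IsSolution N f g v t₀ x₀ S x) {t : ℝ} (ht : t ∈ S) :
    Tendsto (fun p : ℝ × ℝ => x p.1 p.2) (𝓝[>] t ×ˢ 𝓟 J) (𝓝 (x t (1 / 2))) :=
  tendsto_pi_nhds.2 fun j => (hx.isSBVLoc j).isSG.right t ht

theorem IsSolution.tendsto_right_value (hx : IsSolution N f g v t₀ x₀ S x) {t s : ℝ}
    (ht : t ∈ S) (hs : s ∈ J) : Tendsto (fun r => x r s) (𝓝[>] t) (𝓝 (x t (1 / 2))) :=
  tendsto_pi_nhds.2 fun j => ((hx.isSBVLoc j).isSG.right t ht).tendsto_value hs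

theorem IsSolution.initial_value (hx : IsSolution N f g v t₀ x₀ S x) (ht₀ : t₀ ∈ S) :
    x t₀ (-1 / 2) = x₀ := by
  ext j
  exact tendsto_nhds_unique (((hx.isSBVLoc j).isSG.left t₀ ht₀).tendsto_value left_mem_J)
    ((hx.initial j).tendsto_value left_mem_J)

theorem IsSolution.increment_spike (hx : IsSolution N f g v t₀ x₀ S x) {t a b : ℝ} (ht : t ∈ S)
    (ha : -1 / 2 ≤ a) (hab : a ≤ b) (hb : b ≤ 1 / 2) (j : Fin n) :
    x t b j - x t a j = rhs f g v x j (spike t a b) := by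
  rw [← hx.equation j t t le_rfl (by simpa using ht) _ (isTestOn_spike t a b)]
  exact (derivOn_spike (hx.isSBVLoc j).isSG ht ha hab hb).symm

theorem IsSolution.increment_bump (hx : IsSolution N f g v t₀ x₀ S x) {a b : ℝ} (hab : a < b)
    (hS : Icc a b ⊆ S) (j : Fin n) :
    x b (-1 / 2) j - x a (1 / 2) j = rhs f g v x j (bump a b) := by
  rw [← hx.equation j a b hab.le hS _ (isTestOn_bump a b)]
  exact (derivOn_bump (hx.isSBVLoc j) hab hS).symm

/-- Right limits alone provide measurability, since they leave only countably many discontinuities.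
-/
theorem integrable_mul_ord_bump {q : ℝ → ℝ} {a b H : ℝ}
    (hq : ∀ r ∈ Ioo a b, ∃ c, Tendsto q (𝓝[>] r) (𝓝 c)) (hH : ∀ r ∈ Ioo a b, |q r| ≤ H) :
    Integrable (fun r => q r * bump a b r 0) := by
  have : (fun r => q r * bump a b r 0) = (Ioo a b).indicator q := by
    ext r; by_cases hr : r ∈ Ioo a b <;> simp [bump, hr]
  rw [this, integrable_indicator_iff measurableSet_Ioo]
  refine Integrable.of_bound (aestronglyMeasurable_of_tendsto_right measurableSet_Ioo hq) H ?_
  rw [ae_restrict_iff' measurableSet_Ioo]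
  exact Eventually.of_forall fun r hr => hH r hr

theorem summable_indicator_of_subset {u : ℕ → ℝ} (hu : ∀ k, 0 ≤ u k) {A B : Set ℝ} (hAB : A ⊆ B)
    (hB : Summable (fun k => B.indicator (fun _ => u k) (τ k))) :
    Summable (fun k => A.indicator (fun _ => u k) (τ k)) :=
  Summable.of_nonneg_of_le (fun k => indicator_nonneg (fun _ _ => hu k) _)
    (fun k => indicator_le_indicator_of_subset hAB (fun _ => hu k) _) hB

theorem CoeffReg.summable_of_subset (h : CoeffReg I N f Kf g Kg w c τ α) {p q : ℝ}
    (hpq : Icc p q ⊆ I) {A : Set ℝ} (hA : A ⊆ Icc p q) (l : Fin n) :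
    Summable (fun k => A.indicator (fun _ => impulseMass c α l k) (τ k)) :=
  summable_indicator_of_subset (fun _ => impulseMass_nonneg _ _) hA (h.summable p q hpq l)

theorem cutoffMass_bump {a b : ℝ} (hab : a ≤ b) : cutoffMass c τ α (bump a b)
    = (b - a) + ∑ l, ∑' k, (Ioo a b).indicator (fun _ => impulseMass c α l k) (τ k) := by
  simp only [cutoffMass, integral_ord_bump hab, massTerm_bump]

/-- The open intervals `(t, r)` exclude `t` itself, so each impulse is eventually outside; dominated
convergence passes to the series. -/
theorem CoeffReg.tendsto_cutoffMass_bump (h : CoeffReg I N f Kf g Kg w c τ α) {t b : ℝ}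
    (htb : t < b) (hI : Icc t b ⊆ I) :
    Tendsto (fun r => cutoffMass c τ α (bump t r)) (𝓝[>] t) (𝓝 0) := by
  have h1 : Tendsto (fun r => (r - t) +
      ∑ l, ∑' k, (Ioo t r).indicator (fun _ => impulseMass c α l k) (τ k)) (𝓝[>] t)
      (𝓝 (0 + ∑ _l : Fin n, ∑' _k : ℕ, (0 : ℝ))) := by
    refine Tendsto.add ?_ (tendsto_finsetSum _ fun l _ => ?_)
    · have : Continuous (fun r : ℝ => r - t) := by fun_prop
      simpa using (this.tendsto t).mono_left nhdsWithin_le_nhds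
    · refine tendsto_tsum_of_dominated_convergence (h.summable t b hI l) (fun k => ?_) ?_
      · refine tendsto_const_nhds.congr' ?_
        by_cases hk : t < τ k
        · filter_upwards [Ioo_mem_nhdsGT hk] with r hr
          exact (indicator_of_notMem (fun h' => lt_asymm h'.2 hr.2) _).symm
        · exact Eventually.of_forall fun r => (indicator_of_notMem (fun h' => hk h'.1) _).symm
      · filter_upwards [Ioo_mem_nhdsGT htb] with r hr k
        rw [Real.norm_eq_abs, abs_of_nonneg (indicator_nonneg (fun _ _ => impulseMass_nonneg l k) _)]
        exact indicator_le_indicator_of_subset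
          (Ioo_subset_Icc_self.trans (Icc_subset_Icc_right hr.2.le))
          (fun _ => impulseMass_nonneg l k) _
  simp only [tsum_zero, Finset.sum_const_zero, add_zero] at h1
  refine h1.congr' ?_
  filter_upwards [self_mem_nhdsWithin] with r hr
  exact (cutoffMass_bump (le_of_lt hr)).symm

/-- Growth of the distance of a solution to `M` immediately after the time `t`. -/
theorem CoeffReg.eventually_sqDist_le (h : CoeffReg I N f Kf g Kg w c τ α)
    {η : Fin m → (Fin n → ℝ) → ℝ} {M : Set (Fin n → ℝ)} (hM : ConstraintReg η M) (hMN : M ⊆ N)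
    (hx : IsSolution N f g (control w c τ α) t₀ x₀ S x) (hSI : S ⊆ I)
    {Ω : Set ℝ} (hΩ : IsOpen Ω) (hfΩ : ∀ z ∈ N, ContinuousOn (fun t => f t z) Ω)
    {t b : ℝ} (htb : t < b) (hS : Icc t b ⊆ S) (hbΩ : Icc t b ⊆ Ω)
    (hfeas : ∀ y ∈ frontier M, ∀ i, η i y = 0 → ∀ r ∈ Ioo t b,
      grad (η i) y ⬝ᵥ (fun j => rhs f g (control w c τ α) (fun _ _ => y) j (bump t r)) ≤ 0)
    {W : ℝ} (hW0 : 0 ≤ W) (hW : ∀ l, ∀ r ∈ Icc t b, |w r l| ≤ W)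
    (hpos : 0 < sqDist M (x t (1 / 2))) :
    ∀ᶠ t' in 𝓝[>] t, t' < b → sqDist M (x t' (-1 / 2)) ≤ sqDist M (x t (1 / 2)) *
      Real.exp (growthRate n Kf Kg W * cutoffMass c τ α (bump t t')) := by
  have htS : t ∈ S := hS (left_mem_Icc.2 htb.le)
  have htΩ : t ∈ Ω := hbΩ (left_mem_Icc.2 htb.le)
  obtain ⟨y, hyf, R, hR0, hyR, hstep⟩ := exists_sqDist_add_le hM.contDiff hM.eq hM.isClosed
    hM.nonempty hM.independent (lipConst_nonneg (n := n) (Kf := Kf) (Kg := Kg) hW0) hpos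
  have hyN : y ∈ N := hMN (hM.isClosed.frontier_subset hyf)
  -- bounds to the right of `t`
  obtain ⟨F, hF0, hF⟩ : ∃ F, 0 ≤ F ∧ ∀ᶠ r in 𝓝[>] t, ‖f r y‖ ≤ F := by
    refine ⟨‖f t y‖ + 1, by positivity, ?_⟩
    have hc : ContinuousAt (fun r => f r y) t := (hfΩ y hyN).continuousAt (hΩ.mem_nhds htΩ)
    have := hc.norm.eventually_lt_const (u := ‖f t y‖ + 1) (by linarith)
    exact (this.filter_mono nhdsWithin_le_nhds).mono fun _ h => h.le
  obtain ⟨Γ, hΓ0, hΓ⟩ : ∃ Γ, 0 ≤ Γ ∧ ∀ᶠ p in 𝓝[>] t ×ˢ 𝓟 J, ∀ j l, |g p.1 p.2 y j l| ≤ Γ := by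
    refine ⟨∑ j, ∑ l, |g t (1 / 2) y j l| + 1, by positivity, ?_⟩
    rw [eventually_all]; intro j
    rw [eventually_all]; intro l
    have h1 := ((h.isSG y hyN j l).right t (hSI htS)).abs.eventually_lt_const
      (u := |g t (1 / 2) y j l| + 1) (by linarith)
    refine h1.mono fun p hp => hp.le.trans ?_
    gcongr
    calc |g t (1 / 2) y j l| ≤ ∑ l, |g t (1 / 2) y j l| :=
          Finset.single_le_sum (f := fun l => |g t (1 / 2) y j l|) (fun _ _ => abs_nonneg _)
            (Finset.mem_univ l)
      _ ≤ _ := Finset.single_le_sum (f := fun j => ∑ l, |g t (1 / 2) y j l|)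
            (fun _ _ => Finset.sum_nonneg fun _ _ => abs_nonneg _) (Finset.mem_univ j)
  have hclose : ∀ᶠ p in 𝓝[>] t ×ˢ 𝓟 J, ‖x p.1 p.2 - y‖ < R :=
    ((hx.tendsto_right htS).sub_const y).norm.eventually_lt_const hyR
  rw [eventually_prod_principal_iff] at hΓ hclose
  obtain ⟨u, hu, husub⟩ := mem_nhdsGT_iff_exists_Ioo_subset.1 ((hF.and hΓ).and hclose)
  obtain ⟨δ, hδ, hstep⟩ := hstep (F + Γ + n * (W * Γ)) (by positivity)
  have hmass0 := (h.tendsto_cutoffMass_bump htb (hS.trans hSI)).eventually_lt_const hδ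
  filter_upwards [hmass0, Ioo_mem_nhdsGT hu, self_mem_nhdsWithin] with t' ht'δ ht'u htt' ht'b
  have htt : t < t' := htt'
  have hsubIcc : Icc t t' ⊆ Icc t b := Icc_subset_Icc_right ht'b.le
  have hIoo : ∀ r ∈ Ioo t t', r ∈ S ∧ r ∈ I ∧ r ∈ Ω ∧ r ∈ Ioo t u ∧ r ∈ Icc t b := by
    intro r hr
    have h1 : r ∈ Icc t b := hsubIcc (Ioo_subset_Icc_self hr)
    exact ⟨hS h1, hSI (hS h1), hbΩ h1, ⟨hr.1, hr.2.trans ht'u.2⟩, h1⟩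
  set φ := bump t t' with hφ
  have hcut : IsCutoff φ := isCutoff_bump _ _
  have hsupp : ∀ r s, φ r s ≠ 0 → r ∈ Ioo t t' := by
    intro r s hrs
    by_contra hne
    exact hrs (indicator_of_notMem hne _)
  have hmass : ∀ l, Summable (massTerm c τ α φ l) := fun l => by
    have := h.summable_of_subset (hS.trans hSI)
      (Ioo_subset_Icc_self.trans hsubIcc : Ioo t t' ⊆ Icc t b) l
    exact this.congr fun k => (massTerm_bump _ _ _ _).symm
  have hint : Integrable (fun r => φ r 0) := integrable_ord_bump _ _
  have hRφ : ∀ r, ∀ q ∈ J, φ r q ≠ 0 → r ∈ I ∧ x r q ∈ N ∧ ‖x r q - y‖ ≤ R := by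
    intro r q hq hrq
    obtain ⟨h1, h2, -, h4, -⟩ := hIoo r (hsupp r q hrq)
    exact ⟨h2, hx.mem r h1 q hq, le_of_lt ((husub h4).2 q hq)⟩
  have hWφ : ∀ l r, φ r 0 ≠ 0 → |w r l| ≤ W := fun l r hr =>
    hW l r (hIoo r (hsupp r 0 hr)).2.2.2.2
  -- all integrals converge along trajectories `z` close to `y`
  have hpair : ∀ z : ℝ → ℝ → Fin n → ℝ, (∀ r ∈ Ioo t t', ContinuousOn (z r) J) →
      (∀ r ∈ Ioo t t', ∃ z', z' ∈ N ∧ Tendsto (fun q => z q 0) (𝓝[>] r) (𝓝 z')) →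
      (∀ r ∈ Ioo t t', ∀ s ∈ J, z r s ∈ N ∧ ‖z r s - y‖ ≤ R) →
      ∀ j, Pairable w c τ α (fun r => f r (z r 0) j) (fun l r s => g r s (z r s) j l) φ := by
    intro z hzc hzr hzN j
    have hfb : ∀ r ∈ Ioo t t', |f r (z r 0) j| ≤ F + |Kf| * R := by
      intro r hr
      obtain ⟨-, h2, -, h4, -⟩ := hIoo r hr
      obtain ⟨h5, h6⟩ := hzN r hr 0 zero_mem_J
      calc |f r (z r 0) j| ≤ ‖f r (z r 0)‖ := norm_le_pi_norm (f r (z r 0)) j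
        _ = ‖f r y + (f r (z r 0) - f r y)‖ := by rw [add_sub_cancel]
        _ ≤ ‖f r y‖ + ‖f r (z r 0) - f r y‖ := norm_add_le _ _
        _ ≤ F + |Kf| * R := by
          refine add_le_add (husub h4).1.1 ((h.lipF r h2 _ h5 _ hyN).trans ?_)
          exact mul_le_mul (le_abs_self _) h6 (norm_nonneg _) (abs_nonneg _)
    have hgb : ∀ l, ∀ r ∈ Ioo t t', ∀ s ∈ J, |g r s (z r s) j l| ≤ Γ + |Kg| * R := by
      intro l r hr s hs
      obtain ⟨-, h2, -, h4, -⟩ := hIoo r hr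
      obtain ⟨h5, h6⟩ := hzN r hr s hs
      calc |g r s (z r s) j l| = |g r s y j l + (g r s (z r s) j l - g r s y j l)| := by
            rw [add_sub_cancel]
        _ ≤ |g r s y j l| + |g r s (z r s) j l - g r s y j l| := abs_add_le _ _
        _ ≤ Γ + |Kg| * R := by
          refine add_le_add ((husub h4).1.2 s hs j l) ((h.lipG r h2 s hs _ h5 _ hyN j l).trans ?_)
          exact mul_le_mul (le_abs_self _) h6 (norm_nonneg _) (abs_nonneg _)
    have hright : ∀ r ∈ Ioo t t', ∀ᶠ q in 𝓝[>] r, q ∈ Ioo t t' := fun r hr =>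
      nhdsWithin_le_nhds (Ioo_mem_nhds hr.1 hr.2)
    refine Pairable.of_bounds (Γ := Γ + |Kg| * R) h.continuousOn_shape hcut ?_ (fun l => ?_) ?_
      hmass ?_
    -- The right limit of the composite coefficient is obtained by freezing the state at its own
    -- right limit `z'`, where `f` is continuous in time on `Ω`.
    · refine integrable_mul_ord_bump (H := F + |Kf| * R) (fun r hr => ?_) hfb
      obtain ⟨z', hz', hzt⟩ := hzr r hr
      have hc : ContinuousAt (fun q => f q z') r :=
        (hfΩ z' hz').continuousAt (hΩ.mem_nhds (hIoo r hr).2.2.1)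
      refine ⟨f r z' j, tendsto_comp_of_lipschitz (h := fun q p => f q p j) (K := Kf)
        (((continuous_apply j).tendsto _).comp (hc.tendsto.mono_left nhdsWithin_le_nhds)) hzt ?_⟩
      filter_upwards [hright r hr] with q hq
      exact (norm_le_pi_norm (f q (z q 0) - f q z') j).trans
        (h.lipF q (hIoo q hq).2.1 _ (hzN q hq 0 zero_mem_J).1 _ hz')
    · have := integrable_mul_ord_bump (q := fun r => w r l * g r 0 (z r 0) j l) (a := t) (b := t')
        (H := W * (Γ + |Kg| * R)) (fun r hr => ?_) (fun r hr => ?_)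
      · simpa only [mul_assoc] using this
      · obtain ⟨z', hz', hzt⟩ := hzr r hr
        have hwc : ContinuousAt w r :=
          h.continuousOn_w.continuousAt (h.isOpen.mem_nhds (hIoo r hr).2.1)
        refine ⟨w r l * g r (1 / 2) z' j l, Tendsto.mul
          (((continuous_apply l).tendsto _).comp (hwc.tendsto.mono_left nhdsWithin_le_nhds)) ?_⟩
        refine tendsto_comp_of_lipschitz (h := fun q p => g q 0 p j l) (K := Kg)
          (((h.isSG z' hz' j l).right r (hIoo r hr).2.1).tendsto_value zero_mem_J) hzt ?_
        filter_upwards [hright r hr] with q hq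
        exact h.lipG q (hIoo q hq).2.1 0 zero_mem_J _ (hzN q hq 0 zero_mem_J).1 _ hz' j l
      · rw [abs_mul]
        exact mul_le_mul (hW l r (hIoo r hr).2.2.2.2) (hgb l r hr 0 zero_mem_J) (abs_nonneg _) hW0
    · rintro l r ⟨s, hs, hrs⟩
      have hr := hsupp r s hrs
      exact h.continuousOn_value (hIoo r hr).2.1 (hzc r hr) (fun s hs => (hzN r hr s hs).1) j l
    · intro l r s hs hrs
      exact hgb l r (hsupp r s hrs) s hs
  have hp := hpair x (fun r hr => hx.continuousOn_value (hIoo r hr).1)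
    (fun r hr => ⟨_, hx.mem r (hIoo r hr).1 _ right_mem_J,
      hx.tendsto_right_value (hIoo r hr).1 zero_mem_J⟩)
    (fun r hr s hs => ⟨hx.mem r (hIoo r hr).1 s hs, le_of_lt ((husub (hIoo r hr).2.2.2.1).2 s hs)⟩)
  have hp' := hpair (fun _ _ => y) (fun _ _ => continuousOn_const)
    (fun r hr => ⟨y, hyN, tendsto_const_nhds⟩)
    (fun r hr s hs => ⟨hyN, by simpa using hR0.le⟩)
  -- The actual increment from the right limit at `t` to the left limit at `t'` is compared with the
  -- increment driven by the state frozen at `y`, which is feasible by hypothesis.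
  have hres := hstep (cutoffMass c τ α φ) (cutoffMass_nonneg hcut) ht'δ.le
    (fun j => x t' (-1 / 2) j - x t (1 / 2) j)
    (fun j => rhs f g (control w c τ α) (fun _ _ => y) j φ)
    (fun j => by
      rw [hx.increment_bump htt (hsubIcc.trans hS) j]
      exact h.abs_rhs_sub_le hcut hint hmass hyN hR0.le hW0 hRφ hWφ (hp j) (hp' j))
    (fun j => by
      rw [rhs_eq_pairing]
      refine abs_pairing_le h.continuousOn_shape hcut hint hmass hF0 hΓ0 hW0 (fun r hr => ?_) hWφ
        (fun l r q hq hrq => ?_)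
      · exact (norm_le_pi_norm (f r y) j).trans (husub (hIoo r (hsupp r 0 hr)).2.2.2.1).1.1
      · exact (husub (hIoo r (hsupp r q hrq)).2.2.2.1).1.2 q hq j l)
    (fun i hi => hfeas y hyf i hi t' ⟨htt, ht'b⟩)
  have hX : x t (1 / 2) + (fun j => x t' (-1 / 2) j - x t (1 / 2) j) = x t' (-1 / 2) := by
    ext j; simp
  rwa [hX] at hres

/-- The mass of the time interval `[t₀, t)`. -/
noncomputable def elapsedMass (c : ℕ → Fin n → ℝ) (τ : ℕ → ℝ) (α : ℕ → ℝ → Fin n → ℝ)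
    (t₀ t : ℝ) : ℝ :=
  (t - t₀) + ∑ l, ∑' k, (Ico t₀ t).indicator (fun _ => impulseMass c α l k) (τ k)

theorem cutoffMass_full_spike (t : ℝ) : cutoffMass c τ α (spike t (-1 / 2) (1 / 2))
    = ∑ l, ∑' k, ({t} : Set ℝ).indicator (fun _ => impulseMass c α l k) (τ k) := by
  unfold cutoffMass
  rw [integral_congr_ae (ord_spike_ae_eq _ _ _)]
  simp only [Pi.zero_apply, integral_zero, zero_add]
  refine Finset.sum_congr rfl fun l _ => tsum_congr fun k => ?_
  by_cases hk : τ k = t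
  · subst hk
    rw [massTerm_spike_self le_rfl (by norm_num) le_rfl, indicator_of_mem (mem_singleton _),
      impulseMass]
  · rw [massTerm_spike_of_ne hk, indicator_of_notMem (by simpa using hk)]

theorem elapsedMass_nonneg {t : ℝ} (ht : t₀ ≤ t) : 0 ≤ elapsedMass c τ α t₀ t :=
  add_nonneg (sub_nonneg.2 ht) (Finset.sum_nonneg fun _ _ => tsum_nonneg fun _ =>
    indicator_nonneg (fun _ _ => impulseMass_nonneg _ _) _)

/-- The interval `[t₀, t')` splits into `[t₀, t)`, the point `t` and `(t, t')`. The last two are the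
masses spent in the jump estimate and in the estimate just after it. -/
theorem CoeffReg.elapsedMass_add (h : CoeffReg I N f Kf g Kg w c τ α) {t t' : ℝ} (ht : t₀ ≤ t)
    (htt : t < t') (hI : Icc t₀ t' ⊆ I) :
    elapsedMass c τ α t₀ t' = elapsedMass c τ α t₀ t
      + cutoffMass c τ α (spike t (-1 / 2) (1 / 2)) + cutoffMass c τ α (bump t t') := by
  have h1 : ∀ l k, (Ico t₀ t').indicator (fun _ => impulseMass c α l k) (τ k)
      = (Ico t₀ t).indicator (fun _ => impulseMass c α l k) (τ k)
        + ({t} : Set ℝ).indicator (fun _ => impulseMass c α l k) (τ k)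
        + (Ioo t t').indicator (fun _ => impulseMass c α l k) (τ k) := by
    intro l k
    rcases lt_trichotomy (τ k) t with hk | hk | hk
    · simp [indicator, hk, hk.ne, hk.not_gt, hk.trans htt]
    · simp [indicator, hk, ht, htt]
    · simp [indicator, hk, hk.ne', hk.not_gt, ht.trans hk.le]
  have h2 : ∀ l, ∑' k, (Ico t₀ t').indicator (fun _ => impulseMass c α l k) (τ k)
      = ∑' k, (Ico t₀ t).indicator (fun _ => impulseMass c α l k) (τ k)
        + ∑' k, ({t} : Set ℝ).indicator (fun _ => impulseMass c α l k) (τ k)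
        + ∑' k, (Ioo t t').indicator (fun _ => impulseMass c α l k) (τ k) := by
    intro l
    have s1 := h.summable_of_subset hI
      (Ico_subset_Icc_self.trans (Icc_subset_Icc_right htt.le) : Ico t₀ t ⊆ Icc t₀ t') l
    have s2 := h.summable_of_subset hI
      (singleton_subset_iff.2 ⟨ht, htt.le⟩ : ({t} : Set ℝ) ⊆ Icc t₀ t') l
    have s3 := h.summable_of_subset hI
      (Ioo_subset_Icc_self.trans (Icc_subset_Icc_left ht) : Ioo t t' ⊆ Icc t₀ t') l
    rw [tsum_congr (h1 l), (s1.add s2).tsum_add s3, s1.tsum_add s2]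
  rw [cutoffMass_bump htt.le, cutoffMass_full_spike, elapsedMass, elapsedMass]
  simp only [h2, Finset.sum_add_distrib]
  ring

end Solutions

end DynDist

/-! ### Viability: the barrier argument along a trajectory -/

theorem theorem6 {n m : ℕ}
    -- the time interval `I`, the initial time `t₀ ∈ I` and `Ω = (t₀, T) ⊆ I`
    (I : Set ℝ) (hI : IsOpen I) (hIc : I.OrdConnected)
    (t₀ : ℝ) (ht₀ : t₀ ∈ I) (T : EReal) (hT : (t₀ : EReal) < T)
    (Ω : Set ℝ) (hΩ : Ω = {t : ℝ | t₀ < t ∧ (t : EReal) < T}) (hΩI : Ω ⊆ I)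
    -- the set `M = {η_i ≤ 0}`, contained in the open set `N`
    (η : Fin m → (Fin n → ℝ) → ℝ) (hη : ∀ i, ContDiff ℝ 1 (η i))
    (M : Set (Fin n → ℝ)) (hM : M = {x | ∀ i, η i x ≤ 0})
    (hind : ∀ x ∈ frontier M,
      LinearIndependent ℝ (fun i : {i // η i x = 0} => DynDist.grad (η i) x))
    (N : Set (Fin n → ℝ)) (hN : IsOpen N) (hMN : M ⊆ N)
    -- the right-hand side
    (f : ℝ → (Fin n → ℝ) → Fin n → ℝ) (hf : DynDist.IsCaratheodory I N f)
    (hfΩ : ∀ x ∈ N, ContinuousOn (fun t => f t x) Ω)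
    (Kf : ℝ) (hfL : ∀ t ∈ I, ∀ x ∈ N, ∀ y ∈ N, ‖f t x - f t y‖ ≤ Kf * ‖x - y‖)
    (g : ℝ → ℝ → (Fin n → ℝ) → Matrix (Fin n) (Fin n) ℝ)
    (hg : ∀ x ∈ N, ∀ j l, DynDist.IsSG I (fun t s => g t s x j l))
    (Kg : ℝ) (hgL : ∀ t ∈ I, ∀ s ∈ DynDist.J, ∀ x ∈ N, ∀ y ∈ N, ∀ j l,
      |g t s x j l - g t s y j l| ≤ Kg * ‖x - y‖)
    -- the distribution `v = w + ∑ ⟨c_k, δ_{τ_k}^{α_k}⟩`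
    (w : ℝ → Fin n → ℝ) (hw : ContinuousOn w I)
    (c : ℕ → Fin n → ℝ) (τ : ℕ → ℝ) (hτ : ∀ k, τ k ∈ I) (hτi : Function.Injective τ)
    (α : ℕ → ℝ → Fin n → ℝ) (hα : ∀ k, ContinuousOn (α k) DynDist.J)
    (hα1 : ∀ k l, ∫ s in (-1 / 2 : ℝ)..(1 / 2), α k s l = 1)
    (hsum : ∀ l φ, DynDist.IsTest I φ → Summable (fun k => DynDist.impulse c τ α k l φ))
    (hprim : ∃ u : Fin n → DynDist.DynFun, ∀ l,
      DynDist.IsSBVLoc I (u l) ∧ DynDist.DerivEq I (u l) (DynDist.control w c τ α l))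
    -- `(η̇_i(x), f(t,x) + g(t,x)v) ≤ 0` in `𝒯'(Ω)` for all `x ∈ ∂M` and all active `i`
    (hineq : ∀ x ∈ frontier M, ∀ i, η i x = 0 →
      DynDist.NonposOn Ω (fun φ => ∑ j, DynDist.grad (η i) x j *
        DynDist.rhs f g (DynDist.control w c τ α) (fun _ _ => x) j φ))
    -- if `t₀` is one of the `τ_k`, the same for the delta-function at `t₀`, which `𝒯'(Ω)` ignores
    (hineq₀ : ∀ k, τ k = t₀ → ∀ x ∈ frontier M, ∀ i, η i x = 0 →
      DynDist.NonposOn I (fun φ => ∑ j, DynDist.grad (η i) x j *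
        ∑ l, DynDist.mulDist (fun t s => g t s x j l) (DynDist.impulse c τ α k l) φ)) :
    DynDist.HasViability I N f g (DynDist.control w c τ α) M t₀ Ω := by
  open DynDist in
  intro S hSo hSc hSI ht₀S x₀ hx₀ x hx t₁ ht₁
  obtain ⟨u, hu⟩ := hprim
  have h : CoeffReg I N f Kf g Kg w c τ α :=
    ⟨hI, hfL, hg, hgL, hw, hτi, hα, fun p q hpq l =>
      summable_impulseMass hτi hα (hu l).1 (hu l).2 hpq⟩
  have hreg : ConstraintReg η M := ⟨hη, hM, hind, ⟨x₀, hx₀⟩⟩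
  have hΩo : IsOpen Ω := by
    rw [hΩ]
    exact isOpen_Ioi.inter (isOpen_Iio.preimage continuous_coe_real_ereal)
  have ht₀₁ : t₀ ≤ t₁ := by
    rcases ht₁.2 with h1 | h1
    · rw [hΩ] at h1; exact h1.1.le
    · exact (mem_singleton_iff.1 h1).ge
  have hIccS : Icc t₀ t₁ ⊆ S := hSc.out ht₀S ht₁.1
  have hIccΩ : ∀ t ∈ Icc t₀ t₁, t₀ < t → t ∈ Ω := by
    intro t ht htt
    rcases ht₁.2 with h1 | h1
    · rw [hΩ] at h1 ⊢
      exact ⟨htt, lt_of_le_of_lt (EReal.coe_le_coe_iff.2 ht.2) h1.2⟩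
    · rw [mem_singleton_iff.1 h1] at ht
      exact absurd htt (not_lt.2 ht.2)
  -- The growth rate depends on a bound of `w` over `[t₀, t₁]`, so the end time `t₁` is fixed
  -- beforehand.
  obtain ⟨W, hW⟩ := isCompact_Icc.exists_bound_of_continuousOn (hw.mono (hIccS.trans hSI))
  have hW0 : 0 ≤ W := (norm_nonneg _).trans (hW t₀ (left_mem_Icc.2 ht₀₁))
  have hWc : ∀ t ∈ Icc t₀ t₁, ∀ l, |w t l| ≤ W := fun t ht l =>
    (norm_le_pi_norm (w t) l).trans (hW t ht)
  set C := growthRate n Kf Kg W with hC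
  have hC0 : 0 ≤ C := growthRate_nonneg hW0
  have hjump : ∀ t ∈ Icc t₀ t₁, ∀ β₀, 0 < β₀ → sqDist M (x t (-1 / 2)) ≤ β₀ → ∀ s ∈ J,
      sqDist M (x t s) ≤ β₀ * Real.exp (C * cutoffMass c τ α (spike t (-1 / 2) (1 / 2))) := by
    intro t ht β₀ hβ₀ hle
    have htS := hIccS ht
    refine h.sqDist_jump_le hreg hMN (hSI htS) (hx.continuousOn_value htS) (hx.mem t htS)
      (fun a b ha hab hb j => hx.increment_spike htS ha hab hb j) ?_ hW0 (hWc t ht) hβ₀ hle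
    intro k hk y hy i hi a b
    have hnn : ∀ r, ∀ s ∈ J, 0 ≤ spike t a b r s := fun r s _ => (isCutoff_spike t a b).nonneg r s
    -- Spikes at `t₀` are not test functions on `Ω`. There the separate hypothesis on the impulse at
    -- `t₀` is used; it suffices because a spike sees no other term of the right-hand side.
    rcases ht.1.eq_or_lt with rfl | hlt
    · have := hineq₀ k hk y hy i hi (spike t₀ a b)
        ⟨t₀, t₀, le_rfl, by simpa using ht₀, isTestOn_spike _ _ _⟩ hnn
      refine le_trans (le_of_eq ?_) this
      refine Finset.sum_congr rfl fun j _ => ?_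
      subst hk
      exact congrArg (grad (η i) y j * ·) (pairing_spike (w := w) (h := fun t => f t y j)
        (γ := fun l t s => g t s y j l) hτi k a b)
    · exact hineq y hy i hi (spike t a b)
        ⟨t, t, le_rfl, by simpa using hIccΩ t ht hlt, isTestOn_spike _ _ _⟩ hnn
  -- The jump estimate needs a positive initial bound, so it is applied with every `β > 0`, and then
  -- `β → 0`.
  have hzero : ∀ t ∈ Icc t₀ t₁, sqDist M (x t (-1 / 2)) = 0 → ∀ s ∈ J, sqDist M (x t s) = 0 := by
    intro t ht h0 s hs
    have hlim : Tendsto (fun β : ℝ => β * Real.exp (C * cutoffMass c τ α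
        (spike t (-1 / 2) (1 / 2)))) (𝓝[>] 0) (𝓝 0) := by
      have : Continuous (fun β : ℝ => β * Real.exp (C * cutoffMass c τ α
        (spike t (-1 / 2) (1 / 2)))) := by fun_prop
      simpa using (this.tendsto 0).mono_left nhdsWithin_le_nhds
    refine le_antisymm (ge_of_tendsto hlim ?_) (sqDist_nonneg _ _)
    filter_upwards [self_mem_nhdsWithin] with β hβ
    exact hjump t ht β hβ (h0.le.trans (le_of_lt hβ)) s hs
  have hinit : sqDist M (x t₀ (-1 / 2)) = 0 := by
    rw [hx.initial_value ht₀S]; exact sqDist_eq_zero hx₀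
  have hmono : MonotoneOn (elapsedMass c τ α t₀) (Icc t₀ t₁) := by
    intro a ha b hb hab
    rcases hab.eq_or_lt with rfl | hlt
    · exact le_rfl
    rw [h.elapsedMass_add ha.1 hlt ((Icc_subset_Icc_right hb.2).trans (hIccS.trans hSI))]
    have h1 := cutoffMass_nonneg (c := c) (τ := τ) (α := α) (isCutoff_spike a (-1 / 2) (1 / 2))
    have h2 := cutoffMass_nonneg (c := c) (τ := τ) (α := α) (isCutoff_bump a b)
    linarith
  -- The induction runs on the left limits `x t (-1 / 2)`, which are left-continuous in `t`. The
  -- clock `elapsedMass` accordingly counts impulses strictly before `t`.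
  have hflow : ∀ ε, 0 < ε → ∀ t ∈ Icc t₀ t₁, sqDist M (x t (-1 / 2)) ≤
      ε * Real.exp (C * elapsedMass c τ α t₀ t) := by
    intro ε hε
    refine le_of_forall_eventually_le (fun a ha b hb hab => ?_) (fun t ht => ?_) ?_
      (fun t ht hle => ?_)
    · have := hmono ha hb hab
      gcongr
    · exact ((continuous_sqDist M).tendsto _).comp
        (hx.tendsto_left (hIccS (Ioc_subset_Icc_self ht)))
    · rw [hinit]; positivity
    have htI : t ∈ Icc t₀ t₁ := Ico_subset_Icc_self ht
    have hbound := hjump t htI _ (by positivity) hle (1 / 2) right_mem_J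
    rcases (sqDist_nonneg M (x t (1 / 2))).eq_or_lt with h0 | hpos
    · have := (((continuous_sqDist M).tendsto _).comp
        (hx.tendsto_right_value (hIccS htI) left_mem_J)).eventually_lt_const
        (u := ε) (by rw [← h0]; exact hε)
      filter_upwards [this, self_mem_nhdsWithin] with t' ht' htt' _
      refine ht'.le.trans (le_mul_of_one_le_right hε.le (Real.one_le_exp (mul_nonneg hC0 ?_)))
      exact elapsedMass_nonneg (ht.1.trans (le_of_lt htt'))
    -- At `t₀` the jump keeps the distance zero, so a positive distance occurs only at later times.
    -- These lie in `Ω`, where `f` is continuous in time and the main inequality is available.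
    · have hlt : t₀ < t := by
        refine lt_of_le_of_ne ht.1 ?_
        rintro rfl
        exact hpos.ne' (hzero t₀ htI hinit _ right_mem_J)
      have hsub : Icc t t₁ ⊆ Icc t₀ t₁ := Icc_subset_Icc_left ht.1
      have hsubΩ : Icc t t₁ ⊆ Ω := fun r hr => hIccΩ r (hsub hr) (hlt.trans_le hr.1)
      have := h.eventually_sqDist_le hreg hMN hx hSI hΩo hfΩ ht.2 (hsub.trans hIccS) hsubΩ
        (fun y hy i hi r hr => hineq y hy i hi (bump t r)
          ⟨t, r, hr.1.le, (Icc_subset_Icc_right hr.2.le).trans hsubΩ, isTestOn_bump _ _⟩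
          (fun q s _ => (isCutoff_bump t r).nonneg q s))
        hW0 (fun l r hr => hWc r (hsub hr) l) hpos
      filter_upwards [this, self_mem_nhdsWithin] with t' ht' htt' ht'b
      rw [h.elapsedMass_add ht.1 htt' ((Icc_subset_Icc_right ht'b.le).trans (hIccS.trans hSI))]
      calc sqDist M (x t' (-1 / 2))
          ≤ sqDist M (x t (1 / 2)) * Real.exp (C * cutoffMass c τ α (bump t t')) := ht' ht'b
        _ ≤ ε * Real.exp (C * elapsedMass c τ α t₀ t)
            * Real.exp (C * cutoffMass c τ α (spike t (-1 / 2) (1 / 2)))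
            * Real.exp (C * cutoffMass c τ α (bump t t')) := by gcongr
        _ = _ := by rw [mul_add, mul_add, Real.exp_add, Real.exp_add]; ring
  have ht₁I : t₁ ∈ Icc t₀ t₁ := right_mem_Icc.2 ht₀₁
  have hend : sqDist M (x t₁ (-1 / 2)) = 0 := by
    have hlim : Tendsto (fun ε : ℝ => ε * Real.exp (C * elapsedMass c τ α t₀ t₁)) (𝓝[>] 0)
        (𝓝 0) := by
      have : Continuous (fun ε : ℝ => ε * Real.exp (C * elapsedMass c τ α t₀ t₁)) := by fun_prop
      simpa using (this.tendsto 0).mono_left nhdsWithin_le_nhds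
    refine le_antisymm (ge_of_tendsto hlim ?_) (sqDist_nonneg _ _)
    filter_upwards [self_mem_nhdsWithin] with ε hε
    exact hflow ε hε t₁ ht₁I
  intro s hs
  exact mem_of_sqDist_eq_zero hreg.isClosed hreg.nonempty (hzero t₁ ht₁I hend s hs)
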